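/- For a positive integer $d$ let \[ g(d) := \#\{(m,q)\in\mathbb{N}^2 : m<\sqrt d,\ |q-\sqrt d|<m,\ q\mid (d-m^2)\}. \] Put $c_1 := \frac43\log 2 = 0.9241\ldots$. For every real $x>1$ there is a real number $\theta=\theta(x)\in[0,1]$ such that \[ \sum_{d\le x} g(d) = c_1x^{3/2} - 2x - 2\sqrt{x} + \theta\,(x+4\sqrt{x}), \] and moreover \[ \sum_{d\le x} g(d)^2 \le 11.9\,x^2 + 5\,x^{3/2}\log^2(4e^4x), \] where the sums run over the positive integers $d\le x$ and $\log^2 t$ means $(\log t)^2$. -/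

import Mathlib

/-- The pairs `(m, q)` of natural numbers with `m < √d`, `|q - √d| < m` and `q ∣ d - m²`
(divisibility in `ℤ`). The set is finite, since `m < √d` and `q < 2√d`. -/
def gSet (d : ℕ) : Set (ℕ × ℕ) :=
  {p | (p.1 : ℝ) < Real.sqrt d ∧ |(p.2 : ℝ) - Real.sqrt d| < p.1 ∧
    (p.2 : ℤ) ∣ (d : ℤ) - (p.1 : ℤ) ^ 2}

/-- The set counted by `g` is finite, so that `Set.ncard` below is its true cardinality. -/
theorem gSet_finite (d : ℕ) : (gSet d).Finite := by
  obtain ⟨N, hN⟩ := exists_nat_gt (2 * Real.sqrt d)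
  refine Set.Finite.subset (Set.finite_Iic ((N, N) : ℕ × ℕ)) ?_
  rintro ⟨m, q⟩ ⟨h1, h2, -⟩
  have h0 := Real.sqrt_nonneg (d : ℝ)
  have h3 := (abs_lt.mp h2).2
  simp only at h1 h3
  refine ⟨?_, ?_⟩
  · have : (m : ℝ) ≤ N := by linarith
    exact_mod_cast this
  · have : (q : ℝ) ≤ N := by linarith
    exact_mod_cast this

/-- `g(d)`, the number of pairs in `gSet d`. -/
noncomputable def g (d : ℕ) : ℕ := (gSet d).ncard

/-- The constant `c₁ = (4/3) log 2`. -/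
noncomputable def c₁ : ℝ := 4 / 3 * Real.log 2

/-! Writing d = m² + qr turns the defining conditions into |q - r| < 2m, which is symmetric in q and
r. Up to the diagonal q = r, each pair is therefore counted twice by its representative with q ≤ r,
that is with m² + q² ≤ d < (m + q)² (`g_eq`).

Second moment: g(d)² is at most four times the number of pairs of such representatives. Two pairs
(m, q), (m', q') share at most 1 + (interval length)/lcm(q, q') values of d, and none unless gcd(q,
q') divides m² - m'² (`card_common_le`). The ones add up to at most X². For the rest, d is fixed:
given q, the number m lies among q consecutive integers. Splitting the gcd as fh with f ∣ m - m' and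
h ∣ m + m' bounds the sum by d · Σ gcd(f, h)/(fh)², hence by 125d/36 (`sum_gcd_div_mul_le`). The
total is about 10.95x², so of the logarithmic term only a linear amount is needed.

First moment: summing over d first leaves a sum over lattice points (m, q) of a quarter disc of
radius N = √x (`sum_g_eq`). For fixed q the summand is, up to rounding, twice the function min(2m,
(N² - q² - m²)/q), piecewise quadratic in m, so Euler–Maclaurin is exact (`slice_sum_identity`). Its
area is N² - q²/3 - (2/3)·`sliceFun N q`. The function `sliceFun N` is concave with integral N³(4/3
- log 2), so the sum over q is caught between trapezoid and tangent estimates; this produces c₁N³ -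
N². Rounding costs at most one per lattice point, about πN²/4, and the full progressions m + q ≤ K =
⌊N⌋ give back about N² in the upper bound. Since π/4 < 1, room of order N² remains for the errors of
size N log N. -/

/-! ### The symmetry between q and its cofactor -/

/-- The pairs `(m, q)` of positive integers with `m² + q² ≤ d < (m + q)²` and `q ∣ d - m²`. -/
def lowPairs (d : ℕ) : Finset (ℕ × ℕ) :=
  (Finset.Icc 1 d ×ˢ Finset.Icc 1 d).filter fun p =>
    p.1 ^ 2 + p.2 ^ 2 ≤ d ∧ d < (p.1 + p.2) ^ 2 ∧ p.2 ∣ d - p.1 ^ 2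

/-- The pairs in `lowPairs d` with `m² + q² < d`. -/
def strictPairs (d : ℕ) : Finset (ℕ × ℕ) :=
  (lowPairs d).filter fun p => p.1 ^ 2 + p.2 ^ 2 < d

theorem mem_lowPairs {d m q : ℕ} : (m, q) ∈ lowPairs d ↔
    1 ≤ m ∧ 1 ≤ q ∧ m ^ 2 + q ^ 2 ≤ d ∧ d < (m + q) ^ 2 ∧ q ∣ d - m ^ 2 := by
  simp only [lowPairs, Finset.mem_filter, Finset.mem_product, Finset.mem_Icc]
  constructor
  · tauto
  · rintro ⟨h1, h2, h3, h4, h5⟩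
    refine ⟨⟨⟨h1, ?_⟩, h2, ?_⟩, h3, h4, h5⟩ <;> nlinarith

theorem mem_strictPairs {d m q : ℕ} : (m, q) ∈ strictPairs d ↔
    1 ≤ m ∧ 1 ≤ q ∧ m ^ 2 + q ^ 2 < d ∧ d < (m + q) ^ 2 ∧ q ∣ d - m ^ 2 := by
  simp only [strictPairs, Finset.mem_filter, mem_lowPairs]
  constructor
  · tauto
  · rintro ⟨h1, h2, h3, h4, h5⟩
    exact ⟨⟨h1, h2, h3.le, h4, h5⟩, h3⟩

/-- Membership in `gSet d` through the cofactor `r` of `q` in `d - m²`. -/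
theorem mem_gSet_iff {d m q : ℕ} : (m, q) ∈ gSet d ↔
    ∃ r, 1 ≤ m ∧ 1 ≤ q ∧ 1 ≤ r ∧ d = m ^ 2 + q * r ∧ r < q + 2 * m ∧ q < r + 2 * m := by
  have hd0 : (0 : ℝ) ≤ d := Nat.cast_nonneg d
  have hs0 := Real.sqrt_nonneg (d : ℝ)
  have hs := Real.sq_sqrt hd0
  have hm0 : (0 : ℝ) ≤ m := Nat.cast_nonneg m
  have hq0 : (0 : ℝ) ≤ q := Nat.cast_nonneg q
  constructor
  · rintro ⟨h1, h2, h3⟩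
    simp only at h1 h2 h3
    rw [abs_lt] at h2
    obtain ⟨h2a, h2b⟩ := h2
    have hm : (m : ℝ) ^ 2 < d := by nlinarith
    have hmd : m ^ 2 < d := by exact_mod_cast hm
    have hlt : (d : ℝ) < (m + q) ^ 2 := by nlinarith
    have hltn : d < (m + q) ^ 2 := by exact_mod_cast hlt
    have hmpos : 1 ≤ m := by
      rcases Nat.eq_zero_or_pos m with h | h
      · subst h; simp at h2a h2b; linarith
      · exact h
    obtain ⟨k, hk⟩ := h3
    have hqpos : 1 ≤ q := by
      rcases Nat.eq_zero_or_pos q with h | h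
      · subst h; simp at h2a; linarith
      · exact h
    have hkpos : 0 < k := by
      have h4 : (0 : ℤ) < (d : ℤ) - (m : ℤ) ^ 2 := by
        have : ((m ^ 2 : ℕ) : ℤ) < d := by exact_mod_cast hmd
        push_cast at this; linarith
      rw [hk] at h4
      exact pos_of_mul_pos_right h4 (by positivity)
    lift k to ℕ using hkpos.le
    have hdk : d = m ^ 2 + q * k := by
      have : (d : ℤ) = (m : ℤ) ^ 2 + q * k := by linarith
      exact_mod_cast this
    refine ⟨k, hmpos, hqpos, by exact_mod_cast hkpos, hdk, ?_, ?_⟩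
    · by_contra hcon
      push Not at hcon
      have := Nat.mul_le_mul_left q hcon
      nlinarith
    · by_contra hcon
      push Not at hcon
      have h5 : (k : ℝ) + 2 * m ≤ q := by exact_mod_cast hcon
      have h6 : (d : ℝ) = m ^ 2 + q * k := by exact_mod_cast hdk
      have hk0 : (0 : ℝ) ≤ k := Nat.cast_nonneg k
      -- If k + 2m ≤ q, then d = m² + qk ≤ (q - m)², against q - √d < m.
      have h7 : Real.sqrt d ≤ q - m := by
        rw [Real.sqrt_le_left (by linarith)]
        nlinarith
      nlinarith
  · rintro ⟨r, hm, hq, hr, hd, h1, h2⟩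
    have hdR : (d : ℝ) = m ^ 2 + q * r := by exact_mod_cast hd
    have hmR : (1 : ℝ) ≤ m := by exact_mod_cast hm
    have hqR : (1 : ℝ) ≤ q := by exact_mod_cast hq
    have hrR : (1 : ℝ) ≤ r := by exact_mod_cast hr
    have h1R : (r : ℝ) < q + 2 * m := by exact_mod_cast h1
    have h2R : (q : ℝ) < r + 2 * m := by exact_mod_cast h2
    refine ⟨?_, ?_, ?_⟩
    · simp only
      apply Real.lt_sqrt_of_sq_lt
      nlinarith
    · simp only
      rw [abs_lt]
      constructor
      · have : Real.sqrt d < q + m := by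
          rw [Real.sqrt_lt' (by linarith)]
          nlinarith
        linarith
      · have : (q : ℝ) - m < Real.sqrt d := by
          rcases le_or_gt (q : ℝ) m with h | h
          · have : 0 < Real.sqrt d := Real.sqrt_pos.mpr (by nlinarith)
            linarith
          · apply Real.lt_sqrt_of_sq_lt
            nlinarith
        linarith
    · refine ⟨r, ?_⟩
      simp only
      rw [hd]; push_cast; ring

/-- Exchanging `q` with its cofactor identifies the part `m² + q² > d` of `gSet d` with
`strictPairs d`. -/
theorem g_eq (d : ℕ) : g d = (lowPairs d).card + (strictPairs d).card := by
  classical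
  have hset : gSet d = ((lowPairs d ∪
      (strictPairs d).image fun p => (p.1, (d - p.1 ^ 2) / p.2) : Finset (ℕ × ℕ)) :
      Set (ℕ × ℕ)) := by
    ext ⟨m, q⟩
    rw [mem_gSet_iff]
    simp only [Finset.coe_union, Set.mem_union, Finset.mem_coe, Finset.mem_image, Prod.exists,
      Prod.mk.injEq]
    constructor
    · rintro ⟨r, hm, hq, hr, hd, h1, h2⟩
      rcases le_or_gt q r with h | h
      · left
        rw [mem_lowPairs]
        refine ⟨hm, hq, by nlinarith, by nlinarith, ⟨r, ?_⟩⟩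
        rw [hd]; simp
      · right
        refine ⟨m, r, ?_, rfl, ?_⟩
        · rw [mem_strictPairs]
          refine ⟨hm, hr, by nlinarith, by nlinarith, ⟨q, ?_⟩⟩
          rw [hd, mul_comm r q]; simp
        · have : d - m ^ 2 = q * r := by rw [hd]; simp
          rw [this]; exact Nat.mul_div_cancel _ hr
    · rintro (h | ⟨m', r, h, rfl, rfl⟩)
      · rw [mem_lowPairs] at h
        obtain ⟨hm, hq, h1, h2, r, hr⟩ := h
        have hd : d = m ^ 2 + q * r := by
          have : m ^ 2 ≤ d := by nlinarith
          omega
        have hqr : q ≤ r := by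
          by_contra hc
          push Not at hc
          nlinarith
        refine ⟨r, hm, hq, by omega, hd, ?_, by omega⟩
        by_contra hc
        push Not at hc
        nlinarith [Nat.mul_le_mul_left q hc]
      · rw [mem_strictPairs] at h
        obtain ⟨hm, hq, h1, h2, k, hk⟩ := h
        have hd : d = m' ^ 2 + r * k := by
          have : m' ^ 2 ≤ d := by nlinarith
          omega
        have hkr : r < k := by
          by_contra hc
          push Not at hc
          nlinarith
        rw [hk, Nat.mul_div_cancel_left _ (by omega)]
        refine ⟨r, hm, by omega, hq, by rw [hd]; ring, by omega, ?_⟩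
        by_contra hc
        push Not at hc
        nlinarith [Nat.mul_le_mul_left r hc]
  rw [g, hset, Set.ncard_coe_finset, Finset.card_union_of_disjoint, Finset.card_image_of_injOn]
  · rintro ⟨m, q⟩ h ⟨m', q'⟩ h' heq
    simp only [Finset.mem_coe] at h h'
    rw [mem_strictPairs] at h h'
    simp only [Prod.mk.injEq] at heq
    obtain ⟨rfl, heq⟩ := heq
    obtain ⟨hm, hq, h1, h2, k, hk⟩ := h
    obtain ⟨-, hq', -, -, k', hk'⟩ := h'
    have e1 : (d - m ^ 2) / q = k := by rw [hk]; exact Nat.mul_div_cancel_left _ hq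
    have e2 : (d - m ^ 2) / q' = k' := by rw [hk']; exact Nat.mul_div_cancel_left _ hq'
    have hkk : k = k' := by rw [← e1, ← e2]; exact heq
    subst hkk
    have hkpos : 0 < k := by
      rcases Nat.eq_zero_or_pos k with h0 | h0
      · subst h0
        have : 0 < q ^ 2 := by positivity
        omega
      · exact h0
    have : q = q' := Nat.eq_of_mul_eq_mul_right hkpos (hk.symm.trans hk')
    rw [this]
  · rw [Finset.disjoint_left]
    rintro ⟨m, q⟩ h h'
    rw [mem_lowPairs] at h
    simp only [Finset.mem_image, Prod.exists, Prod.mk.injEq] at h'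
    obtain ⟨m', r, h', rfl, rfl⟩ := h'
    rw [mem_strictPairs] at h'
    obtain ⟨hm, hr, h1, h2, k, hk⟩ := h'
    rw [hk, Nat.mul_div_cancel_left _ hr] at h
    obtain ⟨-, hk1, h3, -, -⟩ := h
    have hd : d = m' ^ 2 + r * k := by
      have : m' ^ 2 ≤ d := by nlinarith
      omega
    rcases le_or_gt k r with h | h <;> nlinarith

/-- Only the diagonal m² + q² = d is lost, so the second moment can be handled through `lowPairs`
alone. -/
theorem g_le (d : ℕ) : g d ≤ 2 * (lowPairs d).card := by
  have := Finset.card_filter_le (lowPairs d) fun p => p.1 ^ 2 + p.2 ^ 2 < d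
  rw [g_eq]
  change (strictPairs d).card ≤ _ at this
  omega

/-! ### Residue classes in intervals and gcd sums -/

theorem card_le_of_modEq_of_subset_Ico {s : Finset ℕ} {a b l : ℕ} (hl : 0 < l)
    (hs : s ⊆ Finset.Ico a b) (hmod : ∀ d ∈ s, ∀ d' ∈ s, d ≡ d' [MOD l]) :
    (s.card : ℝ) ≤ (Finset.Ico a b).card / l + 1 := by
  rcases s.eq_empty_or_nonempty with rfl | ⟨v, hv⟩
  · simp only [Finset.card_empty, Nat.cast_zero]; positivity
  have hvI := Finset.mem_Ico.mp (hs hv)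
  have hsub : s ⊆ (Finset.Ico a b).filter (· ≡ v [MOD l]) := fun d hd =>
    Finset.mem_filter.mpr ⟨hs hd, hmod d hd v hv⟩
  have h1 : (s.card : ℤ) ≤ max (⌈((b : ℚ) - v) / l⌉ - ⌈((a : ℚ) - v) / l⌉) 0 := by
    rw [← Nat.Ico_filter_modEq_card a b hl v]
    exact_mod_cast Finset.card_le_card hsub
  have hlq : (0 : ℚ) < l := by exact_mod_cast hl
  have h2 : (s.card : ℚ) ≤ ((b : ℚ) - a) / l + 1 := by
    have h3 : (s.card : ℚ) ≤ max ((⌈((b : ℚ) - v) / l⌉ : ℚ) - ⌈((a : ℚ) - v) / l⌉) 0 := by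
      exact_mod_cast h1
    have hab : (a : ℚ) ≤ b := by exact_mod_cast (by omega : a ≤ b)
    refine h3.trans (max_le ?_ ?_)
    · have h4 := Int.ceil_lt_add_one (((b : ℚ) - v) / l)
      have h5 := Int.le_ceil (((a : ℚ) - v) / l)
      have h6 : ((b : ℚ) - a) / l = (b - v) / l - (a - v) / l := by ring
      rw [h6]; linarith
    · have : 0 ≤ ((b : ℚ) - a) / l := div_nonneg (by linarith) hlq.le
      linarith
  have hab : a ≤ b := by omega
  have h3 : ((s.card : ℚ) : ℝ) ≤ (((b : ℚ) - a) / l + 1 : ℚ) := by exact_mod_cast h2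
  rw [Nat.card_Ico, Nat.cast_sub hab]
  push_cast at h3
  exact h3

/-- An interval whose length is a multiple of l meets each class equally often, so there is no extra
+1. -/
theorem card_le_of_modEq_of_subset_Ioc {s : Finset ℕ} {a l k : ℕ} (hl : 0 < l)
    (hs : s ⊆ Finset.Ioc a (a + l * k)) (hmod : ∀ d ∈ s, ∀ d' ∈ s, d ≡ d' [MOD l]) :
    s.card ≤ k := by
  rcases s.eq_empty_or_nonempty with rfl | ⟨v, hv⟩
  · simp
  have hsub : s ⊆ (Finset.Ioc a (a + l * k)).filter (· ≡ v [MOD l]) := fun d hd =>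
    Finset.mem_filter.mpr ⟨hs hd, hmod d hd v hv⟩
  have h1 := Finset.card_le_card hsub
  have h2 := Nat.Ioc_filter_modEq_card a (a + l * k) hl v
  have hlq : (l : ℚ) ≠ 0 := by exact_mod_cast hl.ne'
  have h3 : (((a + l * k : ℕ) : ℚ) - v) / l = ((a : ℚ) - v) / l + (k : ℕ) := by
    push_cast; field_simp; ring
  rw [h3, Int.floor_add_natCast] at h2
  simp only [add_sub_cancel_left, Nat.cast_nonneg, sup_of_le_left] at h2
  have h4 : ((Finset.Ioc a (a + l * k)).filter (· ≡ v [MOD l])).card = k := by exact_mod_cast h2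
  omega

theorem sum_inv_sq_le (n : ℕ) : ∑ k ∈ Finset.Icc 1 n, 1 / (k : ℝ) ^ 2 ≤ 5 / 3 := by
  -- Telescoping 1/k² ≤ 1/(k - 1/2) - 1/(k + 1/2) from k = 2 on; 5/3 = 1 + 2/3.
  have key : ∀ n : ℕ, ∑ k ∈ Finset.Icc 1 (n + 1), 1 / (k : ℝ) ^ 2 ≤ 5 / 3 - 1 / ((n : ℝ) + 3 / 2) := by
    intro n
    induction n with
    | zero => norm_num
    | succ n ih =>
      rw [Finset.sum_Icc_succ_top (by omega)]
      have hn : (0 : ℝ) ≤ n := Nat.cast_nonneg n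
      have : 1 / (((n + 1 + 1 : ℕ) : ℝ)) ^ 2 ≤ 1 / ((n : ℝ) + 3 / 2) - 1 / ((n + 1 : ℕ) + 3 / 2) := by
        push_cast
        rw [div_sub_div _ _ (by positivity) (by positivity),
          div_le_div_iff₀ (by positivity) (by positivity)]
        nlinarith
      linarith
  rcases n with _ | n
  · norm_num
  · have : (0 : ℝ) ≤ 1 / (n + 3 / 2) := by positivity
    linarith [key n]

theorem sum_inv_cube_le (n : ℕ) : ∑ k ∈ Finset.Icc 1 n, 1 / (k : ℝ) ^ 3 ≤ 5 / 4 := by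
  -- Telescoping 1/k³ ≤ 1/((k - 1)k(k + 1)) from k = 2 on; 5/4 = 1 + 1/4.
  have key : ∀ n : ℕ, ∑ k ∈ Finset.Icc 1 (n + 1), 1 / (k : ℝ) ^ 3 ≤
      5 / 4 - 1 / (2 * ((n : ℝ) + 1) * (n + 2)) := by
    intro n
    induction n with
    | zero => norm_num
    | succ n ih =>
      rw [Finset.sum_Icc_succ_top (by omega)]
      have hn : (0 : ℝ) ≤ n := Nat.cast_nonneg n
      have : 1 / (((n + 1 + 1 : ℕ) : ℝ)) ^ 3 ≤ 1 / (2 * ((n : ℝ) + 1) * (n + 2)) -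
          1 / (2 * ((n + 1 : ℕ) + 1) * ((n + 1 : ℕ) + 2)) := by
        push_cast
        have : 1 / (2 * ((n : ℝ) + 1) * (n + 2)) - 1 / (2 * (n + 1 + 1) * (n + 1 + 2)) =
            1 / ((n + 1) * (n + 2) * (n + 3)) := by
          field_simp; ring
        rw [this]
        apply one_div_le_one_div_of_le (by positivity)
        nlinarith [mul_nonneg hn hn]
      linarith
  rcases n with _ | n
  · norm_num
  · have : (0 : ℝ) ≤ 1 / (2 * (n + 1) * (n + 2)) := by positivity
    linarith [key n]

theorem sum_inv_sq_multiples_le {j : ℕ} (hj : 1 ≤ j) (n : ℕ) :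
    ∑ f ∈ (Finset.Icc 1 n).filter (j ∣ ·), 1 / (f : ℝ) ^ 2 ≤ 5 / 3 / (j : ℝ) ^ 2 := by
  have h1 : ∑ f ∈ (Finset.Icc 1 n).filter (j ∣ ·), 1 / (f : ℝ) ^ 2 ≤
      ∑ k ∈ Finset.Icc 1 n, 1 / ((j * k : ℕ) : ℝ) ^ 2 := by
    rw [← Finset.sum_image (s := Finset.Icc 1 n) (g := fun k => j * k)
      (f := fun f : ℕ => 1 / (f : ℝ) ^ 2)
      (fun a _ b _ h => Nat.eq_of_mul_eq_mul_left hj h)]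
    apply Finset.sum_le_sum_of_subset_of_nonneg
    · intro f hf
      simp only [Finset.mem_filter, Finset.mem_Icc] at hf
      obtain ⟨⟨hf1, hf2⟩, k, rfl⟩ := hf
      refine Finset.mem_image.mpr ⟨k, Finset.mem_Icc.mpr ⟨?_, ?_⟩, rfl⟩
      · exact Nat.pos_of_mul_pos_left hf1
      · nlinarith
    · intros; positivity
  refine h1.trans ?_
  have h2 : ∑ k ∈ Finset.Icc 1 n, 1 / ((j * k : ℕ) : ℝ) ^ 2 =
      (∑ k ∈ Finset.Icc 1 n, 1 / (k : ℝ) ^ 2) / (j : ℝ) ^ 2 := by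
    rw [Finset.sum_div]
    refine Finset.sum_congr rfl fun k _ => ?_
    push_cast
    rw [mul_pow, div_div, mul_comm]
  rw [h2]
  gcongr
  exact sum_inv_sq_le n

/-- Bounding gcd(f, h) by the sum of all common divisors j decouples f from h. The double sum
becomes Σ j (Σ_{j ∣ f} 1/f²)² ≤ (5/3)² Σ 1/j³, and 125/36 = (25/9)(5/4). -/
theorem sum_gcd_div_le (n : ℕ) :
    ∑ f ∈ Finset.Icc 1 n, ∑ h ∈ Finset.Icc 1 n, (f.gcd h : ℝ) / ((f : ℝ) * h) ^ 2 ≤ 125 / 36 := by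
  have h1 : ∀ f ∈ Finset.Icc 1 n, ∀ h ∈ Finset.Icc 1 n, (f.gcd h : ℝ) / ((f : ℝ) * h) ^ 2 ≤
      ∑ j ∈ Finset.Icc 1 n, (j : ℝ) * ((if j ∣ f then 1 / (f : ℝ) ^ 2 else 0) *
        (if j ∣ h then 1 / (h : ℝ) ^ 2 else 0)) := by
    intro f hf h _
    rw [Finset.mem_Icc] at hf
    have hmem : f.gcd h ∈ Finset.Icc 1 n := Finset.mem_Icc.mpr
      ⟨Nat.gcd_pos_of_pos_left _ hf.1, (Nat.gcd_le_left _ hf.1).trans hf.2⟩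
    refine le_trans (le_of_eq ?_) (Finset.single_le_sum (f := fun j : ℕ => (j : ℝ) *
      ((if j ∣ f then 1 / (f : ℝ) ^ 2 else 0) * (if j ∣ h then 1 / (h : ℝ) ^ 2 else 0)))
      (fun j _ => ?_) hmem)
    · simp only [Nat.gcd_dvd_left, Nat.gcd_dvd_right, if_true]
      rw [mul_pow, one_div_mul_one_div, mul_one_div]
    · positivity
  refine (Finset.sum_le_sum fun f hf => Finset.sum_le_sum fun h hh => h1 f hf h hh).trans ?_
  have h2 : ∑ f ∈ Finset.Icc 1 n, ∑ h ∈ Finset.Icc 1 n, ∑ j ∈ Finset.Icc 1 n,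
      (j : ℝ) * ((if j ∣ f then 1 / (f : ℝ) ^ 2 else 0) *
        (if j ∣ h then 1 / (h : ℝ) ^ 2 else 0)) =
      ∑ j ∈ Finset.Icc 1 n, (j : ℝ) * (∑ f ∈ (Finset.Icc 1 n).filter (j ∣ ·),
        1 / (f : ℝ) ^ 2) ^ 2 := by
    rw [Finset.sum_congr rfl fun f _ => Finset.sum_comm, Finset.sum_comm]
    refine Finset.sum_congr rfl fun j _ => ?_
    rw [sq, Finset.sum_filter, Finset.sum_mul_sum, Finset.mul_sum]
    refine Finset.sum_congr rfl fun f _ => ?_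
    rw [Finset.mul_sum]
  rw [h2]
  calc _ ≤ ∑ j ∈ Finset.Icc 1 n, 25 / 9 * (1 / (j : ℝ) ^ 3) := by
        refine Finset.sum_le_sum fun j hj => ?_
        have hj1 := (Finset.mem_Icc.mp hj).1
        have hj0 : (0 : ℝ) < j := by exact_mod_cast hj1
        have h3 := sum_inv_sq_multiples_le hj1 n
        have h4 : 0 ≤ ∑ f ∈ (Finset.Icc 1 n).filter (j ∣ ·), 1 / (f : ℝ) ^ 2 :=
          Finset.sum_nonneg fun _ _ => by positivity
        calc _ ≤ (j : ℝ) * (5 / 3 / (j : ℝ) ^ 2) ^ 2 := by gcongr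
          _ = _ := by field_simp; norm_num
    _ ≤ _ := by
        rw [← Finset.mul_sum]
        linarith [sum_inv_cube_le n]

/-- The number of pairs in a box of `q₁` by `q₂` consecutive integers with
`gcd q₁ q₂ ∣ m₁² - m₂²`. -/
theorem card_gcd_dvd_sq_sub_sq_le {q₁ q₂ : ℕ} (h₁ : 1 ≤ q₁) (a₁ a₂ : ℕ) :
    ((Finset.Ioc a₁ (a₁ + q₁) ×ˢ Finset.Ioc a₂ (a₂ + q₂)).filter fun p =>
      ((q₁.gcd q₂ : ℕ) : ℤ) ∣ (p.1 : ℤ) ^ 2 - (p.2 : ℤ) ^ 2).card * q₁.gcd q₂ ≤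
      q₁ * q₂ * ∑ p ∈ (q₁.gcd q₂).divisorsAntidiagonal, p.1.gcd p.2 := by
  classical
  set e := q₁.gcd q₂ with he
  have he0 : 0 < e := Nat.gcd_pos_of_pos_left _ h₁
  let F : ℕ × ℕ → Finset (ℕ × ℕ) := fun t =>
    (Finset.Ioc a₁ (a₁ + q₁) ×ˢ Finset.Ioc a₂ (a₂ + q₂)).filter fun p =>
      (t.1 : ℤ) ∣ (p.1 : ℤ) - p.2 ∧ (t.2 : ℤ) ∣ (p.1 : ℤ) + p.2
  have hsub : ((Finset.Ioc a₁ (a₁ + q₁) ×ˢ Finset.Ioc a₂ (a₂ + q₂)).filter fun p =>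
      (e : ℤ) ∣ (p.1 : ℤ) ^ 2 - (p.2 : ℤ) ^ 2) ⊆ e.divisorsAntidiagonal.biUnion F := by
    intro p hp
    rw [Finset.mem_filter] at hp
    obtain ⟨hp1, hp2⟩ := hp
    have h3 : (e : ℤ) ∣ ((p.1 : ℤ) - p.2) * (p.1 + p.2) := by
      convert hp2 using 1; ring
    -- From e ∣ (m₁ - m₂)(m₁ + m₂), a factorization of e with one factor dividing each bracket.
    obtain ⟨u, v, hu, hv, huv⟩ := exists_dvd_and_dvd_of_dvd_mul h3
    rw [Finset.mem_biUnion]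
    refine ⟨(u.natAbs, v.natAbs), ?_, ?_⟩
    · rw [Nat.mem_divisorsAntidiagonal]
      refine ⟨?_, he0.ne'⟩
      simp only
      rw [← Int.natAbs_mul, ← huv, Int.natAbs_natCast]
    · refine Finset.mem_filter.mpr ⟨hp1, ?_, ?_⟩
      · simpa using hu
      · simpa using hv
  have hF : ∀ t ∈ e.divisorsAntidiagonal, (F t).card * e ≤ q₁ * q₂ * t.1.gcd t.2 := by
    rintro ⟨f, h⟩ ht
    rw [Nat.mem_divisorsAntidiagonal] at ht
    obtain ⟨hfh, -⟩ := ht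
    simp only at hfh
    have hf0 : 0 < f := Nat.pos_of_mul_pos_right (by rw [hfh]; exact he0)
    have hh0 : 0 < h := Nat.pos_of_mul_pos_left (by rw [hfh]; exact he0)
    have hgl : f.gcd h * f.lcm h = e := by rw [Nat.gcd_mul_lcm, hfh]
    have hl0 : 0 < f.lcm h := Nat.lcm_pos hf0 hh0
    -- Given m₁, the number m₂ is fixed modulo lcm(f, h). This divides e and hence q₂, so each m₁
    -- admits at most k = q₂/lcm(f, h) values.
    obtain ⟨k, hk⟩ : f.lcm h ∣ q₂ :=
      (Dvd.intro_left _ hgl).trans (Nat.gcd_dvd_right q₁ q₂)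
    have hcard : (F (f, h)).card ≤ q₁ * k := by
      rw [Finset.card_eq_sum_card_fiberwise (f := Prod.fst) (t := Finset.Ioc a₁ (a₁ + q₁))]
      · calc _ ≤ ∑ _m ∈ Finset.Ioc a₁ (a₁ + q₁), k := by
              refine Finset.sum_le_sum fun m _ => ?_
              rw [← Finset.card_image_of_injOn (f := Prod.snd)]
              · refine card_le_of_modEq_of_subset_Ioc (a := a₂) hl0 ?_ ?_
                · intro n hn
                  rw [Finset.mem_image] at hn
                  obtain ⟨p, hp, rfl⟩ := hn
                  rw [← hk]
                  simp only [F, Finset.mem_filter, Finset.mem_product] at hp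
                  exact hp.1.1.2
                · intro n hn n' hn'
                  rw [Finset.mem_image] at hn hn'
                  obtain ⟨p, hp, rfl⟩ := hn
                  obtain ⟨p', hp', rfl⟩ := hn'
                  simp only [F, Finset.mem_filter, Finset.mem_product] at hp hp'
                  obtain ⟨⟨-, ha, hb⟩, hc⟩ := hp
                  obtain ⟨⟨-, ha', hb'⟩, hc'⟩ := hp'
                  rw [hc] at ha hb
                  rw [hc'] at ha' hb'
                  rw [Nat.modEq_iff_dvd]
                  have e1 : (f : ℤ) ∣ (p'.2 : ℤ) - p.2 := by
                    have := dvd_sub ha ha'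
                    rwa [sub_sub_sub_cancel_left] at this
                  have e2 : (h : ℤ) ∣ (p'.2 : ℤ) - p.2 := by
                    have := dvd_sub hb' hb
                    rwa [add_sub_add_left_eq_sub] at this
                  rw [Int.natCast_dvd] at e1 e2 ⊢
                  exact Nat.lcm_dvd e1 e2
              · rintro p hp p' hp' hpp
                simp only [Finset.mem_coe, Finset.mem_filter] at hp hp'
                exact Prod.ext (hp.2.trans hp'.2.symm) hpp
          _ = q₁ * k := by simp
      · intro p hp
        simp only [F, Finset.mem_coe, Finset.mem_filter, Finset.mem_product] at hp
        exact hp.1.1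
    calc (F (f, h)).card * e ≤ q₁ * k * (f.gcd h * f.lcm h) := by rw [hgl]; gcongr
      _ = q₁ * (f.lcm h * k) * f.gcd h := by ring
      _ = q₁ * q₂ * f.gcd h := by rw [← hk]
  calc _ ≤ (∑ t ∈ e.divisorsAntidiagonal, (F t).card) * e := by
        gcongr
        exact (Finset.card_le_card hsub).trans Finset.card_biUnion_le
    _ ≤ _ := by
        rw [Finset.sum_mul, Finset.mul_sum]
        exact Finset.sum_le_sum hF

theorem sum_Icc_cast (n : ℕ) : ∑ k ∈ Finset.Icc 1 n, (k : ℝ) = n * (n + 1) / 2 := by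
  induction n with
  | zero => simp
  | succ n ih => rw [Finset.sum_Icc_succ_top (by omega), ih]; push_cast; ring

theorem sum_Icc_cast_sq (n : ℕ) :
    ∑ k ∈ Finset.Icc 1 n, (k : ℝ) ^ 2 = n * (n + 1) * (2 * n + 1) / 6 := by
  induction n with
  | zero => simp
  | succ n ih => rw [Finset.sum_Icc_succ_top (by omega), ih]; push_cast; ring

/-- Exchanging the sums, a factorization (f, h) contributes only when fh divides both entries, which
happens for at most (s/(fh))² pairs. -/
theorem sum_divisorsAntidiagonal_gcd_le (s : ℕ) :
    ∑ t ∈ Finset.Icc 1 s ×ˢ Finset.Icc 1 s,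
      ((∑ p ∈ (t.1.gcd t.2).divisorsAntidiagonal, p.1.gcd p.2 : ℕ) : ℝ) ≤
      125 / 36 * (s : ℝ) ^ 2 := by
  classical
  have h1 : ∀ t ∈ Finset.Icc 1 s ×ˢ Finset.Icc 1 s,
      ((∑ p ∈ (t.1.gcd t.2).divisorsAntidiagonal, p.1.gcd p.2 : ℕ) : ℝ) ≤
      ∑ p ∈ Finset.Icc 1 s ×ˢ Finset.Icc 1 s, (p.1.gcd p.2 : ℝ) *
        ((if p.1 * p.2 ∣ t.1 then 1 else 0) * (if p.1 * p.2 ∣ t.2 then 1 else 0)) := by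
    rintro ⟨a, b⟩ ht
    simp only [Finset.mem_product, Finset.mem_Icc] at ht
    push_cast
    have hsub : (a.gcd b).divisorsAntidiagonal ⊆ Finset.Icc 1 s ×ˢ Finset.Icc 1 s := by
      rintro ⟨f, h⟩ hp
      rw [Nat.mem_divisorsAntidiagonal] at hp
      simp only at hp
      have hle : a.gcd b ≤ s := (Nat.gcd_le_left _ ht.1.1).trans ht.1.2
      have he : 0 < f * h := by rw [hp.1]; exact Nat.pos_of_ne_zero hp.2
      have hf : 0 < f := Nat.pos_of_mul_pos_right he
      have hh : 0 < h := Nat.pos_of_mul_pos_left he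
      simp only [Finset.mem_product, Finset.mem_Icc]
      refine ⟨⟨hf, ?_⟩, hh, ?_⟩ <;> nlinarith [hp.1]
    refine le_trans (Finset.sum_le_sum fun p hp => ?_)
      (Finset.sum_le_sum_of_subset_of_nonneg hsub fun p _ _ => by positivity)
    rw [Nat.mem_divisorsAntidiagonal] at hp
    rw [hp.1, if_pos (Nat.gcd_dvd_left a b), if_pos (Nat.gcd_dvd_right a b)]
    simp
  refine (Finset.sum_le_sum h1).trans ?_
  rw [Finset.sum_comm]
  have h2 : ∀ p ∈ Finset.Icc 1 s ×ˢ Finset.Icc 1 s,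
      ∑ t ∈ Finset.Icc 1 s ×ˢ Finset.Icc 1 s, (p.1.gcd p.2 : ℝ) *
        ((if p.1 * p.2 ∣ t.1 then 1 else 0) * (if p.1 * p.2 ∣ t.2 then 1 else 0)) ≤
      (s : ℝ) ^ 2 * ((p.1.gcd p.2 : ℝ) / ((p.1 : ℝ) * p.2) ^ 2) := by
    rintro ⟨f, h⟩ hp
    simp only [Finset.mem_product, Finset.mem_Icc] at hp
    simp only
    have hfh : (0 : ℝ) < (f : ℝ) * h := by
      have : 0 < f * h := Nat.mul_pos hp.1.1 hp.2.1
      exact_mod_cast this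
    have hc : ∑ a ∈ Finset.Icc 1 s, (if f * h ∣ a then (1 : ℝ) else 0) ≤ s / ((f : ℝ) * h) := by
      rw [Finset.sum_boole]
      have : (Finset.Icc 1 s) = Finset.Ioc 0 s := by ext; simp [Nat.lt_iff_add_one_le]
      rw [this, Nat.Ioc_filter_dvd_card_eq_div]
      exact_mod_cast Nat.cast_div_le (α := ℝ) (m := s) (n := f * h)
    have hc0 : 0 ≤ ∑ a ∈ Finset.Icc 1 s, (if f * h ∣ a then (1 : ℝ) else 0) :=
      Finset.sum_nonneg fun _ _ => by positivity
    rw [← Finset.mul_sum, Finset.sum_product]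
    calc _ = (f.gcd h : ℝ) * ((∑ a ∈ Finset.Icc 1 s, (if f * h ∣ a then (1 : ℝ) else 0)) *
            ∑ a ∈ Finset.Icc 1 s, (if f * h ∣ a then (1 : ℝ) else 0)) := by
          rw [Finset.sum_mul_sum]
      _ ≤ (f.gcd h : ℝ) * (s / ((f : ℝ) * h) * (s / ((f : ℝ) * h))) := by gcongr
      _ = _ := by field_simp
  refine (Finset.sum_le_sum h2).trans ?_
  rw [← Finset.mul_sum, Finset.sum_product, mul_comm]
  gcongr
  exact sum_gcd_div_le s

/-- For a fixed `d`, the sum of `gcd q q' / (q q')` over the pairs `(m, q)`, `(m', q')` with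
`m² + q² ≤ d < (m + q)²`, likewise for `(m', q')`, and `gcd q q' ∣ m² - m'²`. -/
theorem sum_gcd_div_mul_le (d : ℕ) (B : Finset (ℕ × ℕ)) (hB : ∀ p ∈ B, 1 ≤ p.1 ∧ 1 ≤ p.2) :
    ∑ t ∈ (B ×ˢ B).filter (fun t => (t.1.1 ^ 2 + t.1.2 ^ 2 ≤ d ∧ d < (t.1.1 + t.1.2) ^ 2) ∧
        (t.2.1 ^ 2 + t.2.2 ^ 2 ≤ d ∧ d < (t.2.1 + t.2.2) ^ 2) ∧
        ((t.1.2.gcd t.2.2 : ℕ) : ℤ) ∣ (t.1.1 : ℤ) ^ 2 - (t.2.1 : ℤ) ^ 2),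
      (t.1.2.gcd t.2.2 : ℝ) / ((t.1.2 : ℝ) * t.2.2) ≤ 125 / 36 * (d : ℝ) := by
  classical
  set T := (B ×ˢ B).filter (fun t => (t.1.1 ^ 2 + t.1.2 ^ 2 ≤ d ∧ d < (t.1.1 + t.1.2) ^ 2) ∧
        (t.2.1 ^ 2 + t.2.2 ^ 2 ≤ d ∧ d < (t.2.1 + t.2.2) ^ 2) ∧
        ((t.1.2.gcd t.2.2 : ℕ) : ℤ) ∣ (t.1.1 : ℤ) ^ 2 - (t.2.1 : ℤ) ^ 2) with hT
  set s := Nat.sqrt d with hs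
  -- With s = ⌊√d⌋ the conditions force s - q < m ≤ s, which is exactly a block of q consecutive
  -- integers.
  have hbound : ∀ m q : ℕ, m ^ 2 + q ^ 2 ≤ d → d < (m + q) ^ 2 →
      q ≤ s ∧ m ∈ Finset.Ioc (s - q) (s - q + q) := by
    intro m q h1 h2
    have hq : q ≤ s := Nat.le_sqrt'.mpr (by nlinarith)
    have hm : m ≤ s := Nat.le_sqrt'.mpr (by nlinarith)
    have hl : s < m + q := Nat.sqrt_lt'.mpr h2
    rw [Finset.mem_Ioc]
    omega
  have hmaps : ∀ t ∈ T, (t.1.2, t.2.2) ∈ Finset.Icc 1 s ×ˢ Finset.Icc 1 s := by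
    intro t ht
    rw [hT, Finset.mem_filter, Finset.mem_product] at ht
    obtain ⟨⟨ht1, ht2⟩, ⟨h1, h2⟩, ⟨h3, h4⟩, -⟩ := ht
    simp only [Finset.mem_product, Finset.mem_Icc]
    exact ⟨⟨(hB _ ht1).2, (hbound _ _ h1 h2).1⟩, (hB _ ht2).2, (hbound _ _ h3 h4).1⟩
  rw [← Finset.sum_fiberwise_of_maps_to hmaps]
  have hfib : ∀ y ∈ Finset.Icc 1 s ×ˢ Finset.Icc 1 s,
      ∑ t ∈ T.filter (fun t => (t.1.2, t.2.2) = y),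
        (t.1.2.gcd t.2.2 : ℝ) / ((t.1.2 : ℝ) * t.2.2) ≤
      ((∑ p ∈ (y.1.gcd y.2).divisorsAntidiagonal, p.1.gcd p.2 : ℕ) : ℝ) := by
    rintro ⟨q₁, q₂⟩ hy
    simp only [Finset.mem_product, Finset.mem_Icc] at hy
    have hconst : ∀ t ∈ T.filter (fun t => (t.1.2, t.2.2) = (q₁, q₂)),
        (t.1.2.gcd t.2.2 : ℝ) / ((t.1.2 : ℝ) * t.2.2) = (q₁.gcd q₂ : ℝ) / ((q₁ : ℝ) * q₂) := by
      intro t ht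
      have := (Finset.mem_filter.mp ht).2
      simp only [Prod.mk.injEq] at this
      rw [this.1, this.2]
    rw [Finset.sum_congr rfl hconst, Finset.sum_const, nsmul_eq_mul]
    have hq₁ : (0 : ℝ) < q₁ := by exact_mod_cast hy.1.1
    have hq₂ : (0 : ℝ) < q₂ := by exact_mod_cast hy.2.1
    rw [← mul_div_assoc, div_le_iff₀ (by positivity)]
    have hcard : (T.filter (fun t => (t.1.2, t.2.2) = (q₁, q₂))).card ≤
        ((Finset.Ioc (s - q₁) (s - q₁ + q₁) ×ˢ Finset.Ioc (s - q₂) (s - q₂ + q₂)).filter fun p =>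
      ((q₁.gcd q₂ : ℕ) : ℤ) ∣ (p.1 : ℤ) ^ 2 - (p.2 : ℤ) ^ 2).card := by
      refine Finset.card_le_card_of_injOn (fun t => (t.1.1, t.2.1)) ?_ ?_
      · intro t ht
        rw [Finset.mem_coe, Finset.mem_filter, hT, Finset.mem_filter] at ht
        obtain ⟨⟨-, ⟨h1, h2⟩, ⟨h3, h4⟩, h5⟩, h6⟩ := ht
        simp only [Prod.mk.injEq] at h6
        obtain ⟨rfl, rfl⟩ := h6
        rw [Finset.mem_coe, Finset.mem_filter, Finset.mem_product]
        exact ⟨⟨(hbound _ _ h1 h2).2, (hbound _ _ h3 h4).2⟩, h5⟩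
      · rintro ⟨⟨m, q⟩, ⟨m', q'⟩⟩ ht ⟨⟨n, r⟩, ⟨n', r'⟩⟩ ht' h
        rw [Finset.mem_coe, Finset.mem_filter] at ht ht'
        have h1 := ht.2
        have h2 := ht'.2
        simp only [Prod.mk.injEq] at h1 h2 h ⊢
        exact ⟨⟨h.1, h1.1.trans h2.1.symm⟩, h.2, h1.2.trans h2.2.symm⟩
    have := card_gcd_dvd_sq_sub_sq_le hy.1.1 (q₂ := q₂) (s - q₁) (s - q₂)
    have h3 := (Nat.mul_le_mul_right (q₁.gcd q₂) hcard).trans this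
    rw [mul_comm (q₁ * q₂)] at h3
    exact_mod_cast h3
  refine (Finset.sum_le_sum hfib).trans ((sum_divisorsAntidiagonal_gcd_le s).trans ?_)
  have : (s : ℝ) ^ 2 ≤ d := by exact_mod_cast Nat.sqrt_le' d
  linarith

/-! ### The second moment -/

/-- The congruences d ≡ m² mod q and d ≡ m'² mod q' put d into at most one class modulo lcm(q, q'),
and are incompatible unless the gcd divides m² - m'². The interval length is written as a sum over d
so that the order of summation can be exchanged afterwards. -/
theorem card_common_le (X m q m' q' : ℕ) (hq : 1 ≤ q) (hq' : 1 ≤ q') :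
    (((Finset.Icc 1 X).filter fun d => (m, q) ∈ lowPairs d ∧ (m', q') ∈ lowPairs d).card : ℝ) ≤
      1 + ∑ d ∈ Finset.Icc 1 X, if (m ^ 2 + q ^ 2 ≤ d ∧ d < (m + q) ^ 2) ∧
        (m' ^ 2 + q' ^ 2 ≤ d ∧ d < (m' + q') ^ 2) ∧
        ((q.gcd q' : ℕ) : ℤ) ∣ (m : ℤ) ^ 2 - (m' : ℤ) ^ 2 then
          (q.gcd q' : ℝ) / ((q : ℝ) * q') else 0 := by
  classical
  set D := (Finset.Icc 1 X).filter fun d => (m, q) ∈ lowPairs d ∧ (m', q') ∈ lowPairs d with hD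
  have hnn : 0 ≤ ∑ d ∈ Finset.Icc 1 X, if (m ^ 2 + q ^ 2 ≤ d ∧ d < (m + q) ^ 2) ∧
        (m' ^ 2 + q' ^ 2 ≤ d ∧ d < (m' + q') ^ 2) ∧
        ((q.gcd q' : ℕ) : ℤ) ∣ (m : ℤ) ^ 2 - (m' : ℤ) ^ 2 then
          (q.gcd q' : ℝ) / ((q : ℝ) * q') else 0 :=
    Finset.sum_nonneg fun _ _ => by positivity
  have hcong : ∀ {d m q : ℕ}, (m, q) ∈ lowPairs d → (q : ℤ) ∣ (d : ℤ) - (m : ℤ) ^ 2 := by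
    intro d m q h
    rw [mem_lowPairs] at h
    obtain ⟨-, -, h1, -, k, hk⟩ := h
    have : d = m ^ 2 + q * k := by
      have : m ^ 2 ≤ d := by nlinarith
      omega
    exact ⟨k, by rw [this]; push_cast; ring⟩
  rcases D.eq_empty_or_nonempty with h0 | ⟨d₀, hd₀⟩
  · rw [h0, Finset.card_empty]; push_cast; linarith
  have hdvd : ((q.gcd q' : ℕ) : ℤ) ∣ (m : ℤ) ^ 2 - (m' : ℤ) ^ 2 := by
    rw [hD, Finset.mem_filter] at hd₀
    have e1 := (Int.natCast_dvd_natCast.mpr (Nat.gcd_dvd_left q q')).trans (hcong hd₀.2.1)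
    have e2 := (Int.natCast_dvd_natCast.mpr (Nat.gcd_dvd_right q q')).trans (hcong hd₀.2.2)
    have := dvd_sub e2 e1
    rwa [sub_sub_sub_cancel_left] at this
  set a := max 1 (max (m ^ 2 + q ^ 2) (m' ^ 2 + q' ^ 2)) with ha
  set b := min (X + 1) (min ((m + q) ^ 2) ((m' + q') ^ 2)) with hb
  have hlcm : 0 < q.lcm q' := Nat.lcm_pos hq hq'
  have hcard : (D.card : ℝ) ≤ (Finset.Ico a b).card / (q.lcm q' : ℕ) + 1 := by
    refine card_le_of_modEq_of_subset_Ico hlcm ?_ ?_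
    · intro d hd
      rw [hD, Finset.mem_filter, Finset.mem_Icc, mem_lowPairs, mem_lowPairs] at hd
      rw [Finset.mem_Ico, ha, hb]
      omega
    · intro d hd d' hd'
      rw [hD, Finset.mem_filter] at hd hd'
      rw [Nat.modEq_iff_dvd, Int.natCast_dvd]
      have e1 := dvd_sub (hcong hd'.2.1) (hcong hd.2.1)
      have e2 := dvd_sub (hcong hd'.2.2) (hcong hd.2.2)
      rw [sub_sub_sub_cancel_right, Int.natCast_dvd] at e1 e2
      exact Nat.lcm_dvd e1 e2
  have hI : Finset.Ico a b ⊆ (Finset.Icc 1 X).filter fun d =>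
      (m ^ 2 + q ^ 2 ≤ d ∧ d < (m + q) ^ 2) ∧ (m' ^ 2 + q' ^ 2 ≤ d ∧ d < (m' + q') ^ 2) ∧
        ((q.gcd q' : ℕ) : ℤ) ∣ (m : ℤ) ^ 2 - (m' : ℤ) ^ 2 := by
    intro d hd
    rw [Finset.mem_Ico, ha, hb] at hd
    rw [Finset.mem_filter, Finset.mem_Icc]
    refine ⟨by omega, by omega, by omega, hdvd⟩
  rw [← Finset.sum_filter, Finset.sum_const, nsmul_eq_mul]
  have hq0 : (0 : ℝ) < q := by exact_mod_cast hq
  have hq0' : (0 : ℝ) < q' := by exact_mod_cast hq'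
  have hinv : (q.gcd q' : ℝ) / ((q : ℝ) * q') = 1 / (q.lcm q' : ℕ) := by
    have hl0 : (0 : ℝ) < (q.lcm q' : ℕ) := by exact_mod_cast hlcm
    rw [div_eq_div_iff (by positivity) hl0.ne']
    have := Nat.gcd_mul_lcm q q'
    rw [one_mul]
    exact_mod_cast this
  rw [hinv, mul_one_div, add_comm]
  refine hcard.trans ?_
  gcongr

theorem sum_card_lowPairs_sq_le (X : ℕ) :
    ∑ d ∈ Finset.Icc 1 X, ((lowPairs d).card : ℝ) ^ 2 ≤
      (X : ℝ) ^ 2 + 125 / 36 * ((X : ℝ) * (X + 1) / 2) := by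
  classical
  set S := Nat.sqrt X
  set B := Finset.Icc 1 S ×ˢ Finset.Icc 1 S with hB
  have hBmem : ∀ p ∈ B, 1 ≤ p.1 ∧ 1 ≤ p.2 := by
    intro p hp
    rw [hB, Finset.mem_product, Finset.mem_Icc, Finset.mem_Icc] at hp
    exact ⟨hp.1.1, hp.2.1⟩
  have hsub : ∀ d ∈ Finset.Icc 1 X, lowPairs d ⊆ B := by
    rintro d hd ⟨m, q⟩ hp
    rw [Finset.mem_Icc] at hd
    rw [mem_lowPairs] at hp
    rw [hB, Finset.mem_product, Finset.mem_Icc, Finset.mem_Icc]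
    exact ⟨⟨hp.1, Nat.le_sqrt'.mpr (by nlinarith)⟩, hp.2.1, Nat.le_sqrt'.mpr (by nlinarith)⟩
  have hsq : ∀ d ∈ Finset.Icc 1 X, ((lowPairs d).card : ℝ) ^ 2 =
      ∑ t ∈ B ×ˢ B, if t.1 ∈ lowPairs d ∧ t.2 ∈ lowPairs d then (1 : ℝ) else 0 := by
    intro d hd
    have h1 : (lowPairs d ×ˢ lowPairs d) =
        (B ×ˢ B).filter fun t => t.1 ∈ lowPairs d ∧ t.2 ∈ lowPairs d := by
      ext t
      simp only [Finset.mem_product, Finset.mem_filter]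
      exact ⟨fun h => ⟨⟨hsub d hd h.1, hsub d hd h.2⟩, h⟩, fun h => h.2⟩
    rw [Finset.sum_boole, ← h1, Finset.card_product]
    push_cast; ring
  rw [Finset.sum_congr rfl hsq, Finset.sum_comm]
  have h2 : ∀ t ∈ B ×ˢ B, ∑ d ∈ Finset.Icc 1 X,
      (if t.1 ∈ lowPairs d ∧ t.2 ∈ lowPairs d then (1 : ℝ) else 0) ≤
      1 + ∑ d ∈ Finset.Icc 1 X, if (t.1.1 ^ 2 + t.1.2 ^ 2 ≤ d ∧ d < (t.1.1 + t.1.2) ^ 2) ∧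
        (t.2.1 ^ 2 + t.2.2 ^ 2 ≤ d ∧ d < (t.2.1 + t.2.2) ^ 2) ∧
        ((t.1.2.gcd t.2.2 : ℕ) : ℤ) ∣ (t.1.1 : ℤ) ^ 2 - (t.2.1 : ℤ) ^ 2 then
          (t.1.2.gcd t.2.2 : ℝ) / ((t.1.2 : ℝ) * t.2.2) else 0 := by
    intro t ht
    rw [Finset.mem_product] at ht
    rw [Finset.sum_boole]
    exact card_common_le X t.1.1 t.1.2 t.2.1 t.2.2 (hBmem _ ht.1).2 (hBmem _ ht.2).2
  refine (Finset.sum_le_sum h2).trans ?_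
  rw [Finset.sum_add_distrib, Finset.sum_comm]
  have hS : (S : ℝ) ^ 2 ≤ X := by exact_mod_cast Nat.sqrt_le' X
  refine add_le_add ?_ ?_
  -- There are S⁴ ≤ X² pairs of pairs, each contributing the 1.
  · rw [Finset.sum_const, Finset.card_product, hB, Finset.card_product, Nat.card_Icc]
    simp only [add_tsub_cancel_right, nsmul_eq_mul, mul_one]
    push_cast
    nlinarith [sq_nonneg (S : ℝ)]
  · calc _ ≤ ∑ d ∈ Finset.Icc 1 X, 125 / 36 * (d : ℝ) := by
          refine Finset.sum_le_sum fun d _ => ?_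
          rw [← Finset.sum_filter]
          exact sum_gcd_div_mul_le d B hBmem
      _ = _ := by
          rw [← Finset.mul_sum]
          rw [sum_Icc_cast]

theorem sum_g_sq_le {x : ℝ} (hx : 1 < x) :
    ∑ d ∈ Finset.Icc 1 ⌊x⌋₊, (g d : ℝ) ^ 2 ≤
      11.9 * x ^ 2 + 5 * x ^ (3 / 2 : ℝ) * (Real.log (4 * Real.exp 4 * x)) ^ 2 := by
  have h1 : ∑ d ∈ Finset.Icc 1 ⌊x⌋₊, (g d : ℝ) ^ 2 ≤
      4 * ∑ d ∈ Finset.Icc 1 ⌊x⌋₊, ((lowPairs d).card : ℝ) ^ 2 := by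
    rw [Finset.mul_sum]
    refine Finset.sum_le_sum fun d _ => ?_
    have h : (g d : ℝ) ≤ 2 * (lowPairs d).card := by exact_mod_cast g_le d
    have h0 : (0 : ℝ) ≤ g d := Nat.cast_nonneg _
    nlinarith
  have h2 := sum_card_lowPairs_sq_le ⌊x⌋₊
  have hX : (⌊x⌋₊ : ℝ) ≤ x := Nat.floor_le (by linarith)
  have hX0 : (0 : ℝ) ≤ ⌊x⌋₊ := Nat.cast_nonneg _
  have hlog : 4 ≤ Real.log (4 * Real.exp 4 * x) := by
    rw [Real.le_log_iff_exp_le (by positivity)]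
    nlinarith [Real.exp_pos 4]
  have hpow : x ≤ x ^ (3 / 2 : ℝ) := Real.self_le_rpow_of_one_le hx.le (by norm_num)
  -- The leading constant is 4 + 125/18 < 11.9; the remaining linear term 125x/18 is covered by 80x,
  -- since the logarithm is at least 4.
  have h3 : 5 * x * 16 ≤ 5 * x ^ (3 / 2 : ℝ) * (Real.log (4 * Real.exp 4 * x)) ^ 2 := by
    gcongr
    nlinarith
  nlinarith

/-! ### The slice function: concavity, integral and sum -/

/-- Stands in for comparing integrals of f and p, which appear only as increments of
antiderivatives. -/
theorem sub_le_sub_of_hasDerivAt_le {F P f p : ℝ → ℝ} {a b : ℝ} (hab : a ≤ b)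
    (hF : ContinuousOn F (Set.Icc a b)) (hP : ContinuousOn P (Set.Icc a b))
    (hF' : ∀ t ∈ Set.Ioo a b, HasDerivAt F (f t) t)
    (hP' : ∀ t ∈ Set.Ioo a b, HasDerivAt P (p t) t)
    (hfp : ∀ t ∈ Set.Ioo a b, f t ≤ p t) : F b - F a ≤ P b - P a := by
  have hmono : MonotoneOn (fun t => P t - F t) (Set.Icc a b) := by
    refine monotoneOn_of_deriv_nonneg (convex_Icc a b) (hP.sub hF) ?_ ?_
    · rw [interior_Icc]
      intro t ht
      exact ((hP' t ht).sub (hF' t ht)).differentiableAt.differentiableWithinAt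
    · rw [interior_Icc]
      intro t ht
      have := ((hP' t ht).sub (hF' t ht)).deriv
      change 0 ≤ deriv (P - F) t
      rw [this]
      linarith [hfp t ht]
  have := hmono (Set.left_mem_Icc.mpr hab) (Set.right_mem_Icc.mpr hab) hab
  simp only at this
  linarith

/-- The function `(N³ - (N² - q²)^{3/2}) / q` in a form without removable singularity. -/
noncomputable def sliceFun (N q : ℝ) : ℝ :=
  q * (Real.sqrt (N ^ 2 - q ^ 2) + N ^ 2 / (N + Real.sqrt (N ^ 2 - q ^ 2)))

/-- An antiderivative of `sliceFun N`. -/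
noncomputable def slicePrim (N q : ℝ) : ℝ :=
  -(Real.sqrt (N ^ 2 - q ^ 2)) ^ 3 / 3 - N ^ 2 * Real.sqrt (N ^ 2 - q ^ 2) +
    N ^ 3 * Real.log (N + Real.sqrt (N ^ 2 - q ^ 2))

section slice

variable {N : ℝ}

theorem hasDerivAt_sqrt_sq_sub_sq {q : ℝ} (h0 : 0 < q) (h1 : q < N) :
    HasDerivAt (fun t => Real.sqrt (N ^ 2 - t ^ 2)) (-(q / Real.sqrt (N ^ 2 - q ^ 2))) q := by
  have hpos : 0 < N ^ 2 - q ^ 2 := by nlinarith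
  have h := (((hasDerivAt_id q).pow 2).const_sub (N ^ 2)).sqrt hpos.ne'
  have : Real.sqrt (N ^ 2 - q ^ 2) ≠ 0 := (Real.sqrt_pos.mpr hpos).ne'
  refine h.congr_deriv ?_
  simp only [Pi.pow_apply, id, Nat.cast_ofNat]
  field_simp
  norm_num

theorem hasDerivAt_sliceFun {q : ℝ} (h0 : 0 < q) (h1 : q < N) :
    HasDerivAt (sliceFun N) (2 * Real.sqrt (N ^ 2 - q ^ 2) -
      N ^ 2 / (N + Real.sqrt (N ^ 2 - q ^ 2))) q := by
  have hpos : 0 < N ^ 2 - q ^ 2 := by nlinarith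
  have hN : 0 < N := h0.trans h1
  have hb := hasDerivAt_sqrt_sq_sub_sq h0 h1
  have hb0 : 0 < Real.sqrt (N ^ 2 - q ^ 2) := Real.sqrt_pos.mpr hpos
  have hsq := Real.sq_sqrt hpos.le
  have h := (hasDerivAt_id q).mul (hb.add ((hasDerivAt_const q (N ^ 2)).div
    (hb.const_add N) (by positivity)))
  refine h.congr_deriv ?_
  simp only [id, Pi.add_apply, Pi.div_apply]
  set b := Real.sqrt (N ^ 2 - q ^ 2)
  have hq : q ^ 2 = N ^ 2 - b ^ 2 := by linarith
  have : N + b ≠ 0 := by positivity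
  field_simp
  ring_nf
  simp only [hq]
  ring

theorem hasDerivAt_slicePrim {q : ℝ} (h0 : 0 < q) (h1 : q < N) :
    HasDerivAt (slicePrim N) (sliceFun N q) q := by
  have hpos : 0 < N ^ 2 - q ^ 2 := by nlinarith
  have hb := hasDerivAt_sqrt_sq_sub_sq h0 h1
  have hb0 : 0 < Real.sqrt (N ^ 2 - q ^ 2) := Real.sqrt_pos.mpr hpos
  have hN : 0 < N := h0.trans h1
  have h := (((hb.pow 3).neg.div_const 3).sub (hb.const_mul (N ^ 2))).add
    (((hb.const_add N).log (by positivity)).const_mul (N ^ 3))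
  refine h.congr_deriv ?_
  simp only [sliceFun]
  set b := Real.sqrt (N ^ 2 - q ^ 2)
  have : N + b ≠ 0 := by positivity
  push_cast
  field_simp
  ring

theorem continuousOn_sliceFun (hN : 0 < N) : ContinuousOn (sliceFun N) (Set.Icc 0 N) := by
  unfold sliceFun
  have : ∀ q ∈ Set.Icc 0 N, N + Real.sqrt (N ^ 2 - q ^ 2) ≠ 0 := fun q _ => by positivity
  fun_prop (disch := assumption)

theorem continuousOn_slicePrim (hN : 0 < N) : ContinuousOn (slicePrim N) (Set.Icc 0 N) := by
  unfold slicePrim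
  have : ∀ q ∈ Set.Icc 0 N, N + Real.sqrt (N ^ 2 - q ^ 2) ≠ 0 := fun q _ => by positivity
  fun_prop (disch := assumption)

/-- With b = √(N² - q²) the derivative is 2b - N²/(N + b), increasing in b and so decreasing in q.
-/
theorem concaveOn_sliceFun (hN : 0 < N) : ConcaveOn ℝ (Set.Icc 0 N) (sliceFun N) := by
  refine AntitoneOn.concaveOn_of_deriv (convex_Icc 0 N) (continuousOn_sliceFun hN) ?_ ?_
  · rw [interior_Icc]
    intro q hq
    exact (hasDerivAt_sliceFun hq.1 hq.2).differentiableAt.differentiableWithinAt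
  · rw [interior_Icc]
    intro p hp q hq hpq
    rw [(hasDerivAt_sliceFun hp.1 hp.2).deriv, (hasDerivAt_sliceFun hq.1 hq.2).deriv]
    have h1 : Real.sqrt (N ^ 2 - q ^ 2) ≤ Real.sqrt (N ^ 2 - p ^ 2) :=
      Real.sqrt_le_sqrt (by nlinarith [hp.1])
    have h2 : N ^ 2 / (N + Real.sqrt (N ^ 2 - p ^ 2)) ≤ N ^ 2 / (N + Real.sqrt (N ^ 2 - q ^ 2)) := by
      gcongr
    linarith

theorem sliceFun_zero : sliceFun N 0 = 0 := by simp [sliceFun]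

theorem sliceFun_self (hN : 0 < N) : sliceFun N N = N ^ 2 := by
  simp [sliceFun]; field_simp

theorem slicePrim_self_sub_zero (hN : 0 < N) :
    slicePrim N N - slicePrim N 0 = N ^ 3 * (4 / 3 - Real.log 2) := by
  have h : N + N = 2 * N := by ring
  simp only [slicePrim, sub_self, Real.sqrt_zero, ne_eq, OfNat.ofNat_ne_zero, not_false_eq_true,
    zero_pow, sub_zero, Real.sqrt_sq hN.le, add_zero, h, Real.log_mul two_ne_zero hN.ne']
  ring

/-- The tangent at the endpoint q = N, where the square root is not differentiable; its slope -N is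
the limit of the derivative at b = 0. -/
theorem sliceFun_le_tangent_self (hN : 0 < N) {q : ℝ} (hq : q ∈ Set.Icc 0 N) :
    sliceFun N q ≤ N ^ 2 + -N * (q - N) := by
  unfold sliceFun
  have hpos : 0 ≤ N ^ 2 - q ^ 2 := by nlinarith [hq.1, hq.2]
  have hsq := Real.sq_sqrt hpos
  have hb0 := Real.sqrt_nonneg (N ^ 2 - q ^ 2)
  set b := Real.sqrt (N ^ 2 - q ^ 2)
  have hbN : b ≤ N := by nlinarith [sq_nonneg q]
  have key : q * (2 * N ^ 2 + 2 * N * b + b ^ 2) ≤ 2 * N ^ 2 * (N + b) := by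
    -- Squaring removes q through q² = (N - b)(N + b), leaving a polynomial inequality in N and b.
    refine le_of_sq_le_sq ?_ (by positivity)
    have hq2 : q ^ 2 = (N - b) * (N + b) := by linarith
    rw [mul_pow, hq2]
    have h1 : (N - b) * (2 * N ^ 2 + 2 * N * b + b ^ 2) ^ 2 ≤ 4 * N ^ 4 * (N + b) := by
      have : 0 ≤ 4 * N ^ 2 * b ^ 3 + 3 * N * b ^ 4 + b ^ 5 := by positivity
      nlinarith
    have h2 := mul_le_mul_of_nonneg_left h1 (by positivity : 0 ≤ N + b)
    nlinarith
  have h3 : q * (b + N ^ 2 / (N + b)) = q * (N * b + b ^ 2 + N ^ 2) / (N + b) := by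
    field_simp
  rw [h3, div_le_iff₀ (by positivity)]
  nlinarith

/-- A supporting line of the concave function `sliceFun N` with slope at least `-N`. -/
theorem exists_sliceFun_le_tangent (hN : 0 < N) {p : ℝ} (h0 : 0 < p) (h1 : p ≤ N) :
    ∃ s, -N ≤ s ∧ ∀ q ∈ Set.Icc 0 N, sliceFun N q ≤ sliceFun N p + s * (q - p) := by
  rcases h1.lt_or_eq with h1 | rfl
  · refine ⟨2 * Real.sqrt (N ^ 2 - p ^ 2) - N ^ 2 / (N + Real.sqrt (N ^ 2 - p ^ 2)), ?_,
      fun q hq => ?_⟩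
    · have hb0 := Real.sqrt_nonneg (N ^ 2 - p ^ 2)
      have : N ^ 2 / (N + Real.sqrt (N ^ 2 - p ^ 2)) ≤ N := by
        rw [div_le_iff₀ (by positivity)]; nlinarith
      linarith
    · have hd := hasDerivAt_sliceFun h0 h1
      have hc := concaveOn_sliceFun hN
      have hp : p ∈ Set.Icc 0 N := ⟨h0.le, h1.le⟩
      rcases lt_trichotomy q p with h | h | h
      · have := hc.le_slope_of_hasDerivAt hq hp h hd
        rw [slope_def_field, le_div_iff₀ (by linarith)] at this
        linarith
      · subst h; simp
      · have := hc.slope_le_of_hasDerivAt hp hq h hd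
        rw [slope_def_field, div_le_iff₀ (by linarith)] at this
        linarith
  · refine ⟨-p, le_rfl, fun q hq => ?_⟩
    rw [sliceFun_self hN]
    exact sliceFun_le_tangent_self hN hq

theorem slicePrim_sub_le (hN : 0 < N) {a b A s p : ℝ} (ha : 0 ≤ a) (hab : a ≤ b) (hb : b ≤ N)
    (h : ∀ q ∈ Set.Icc 0 N, sliceFun N q ≤ A + s * (q - p)) :
    slicePrim N b - slicePrim N a ≤ A * (b - a) + s * ((b - p) ^ 2 - (a - p) ^ 2) / 2 := by
  have := sub_le_sub_of_hasDerivAt_le (F := slicePrim N) (f := sliceFun N)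
    (P := fun t => A * t + s * (t - p) ^ 2 / 2) (p := fun t => A + s * (t - p)) hab
    ((continuousOn_slicePrim hN).mono (Set.Icc_subset_Icc ha hb))
    (by fun_prop)
    (fun t ht => hasDerivAt_slicePrim (by linarith [ht.1]) (by linarith [ht.2]))
    (fun t _ => by
      have h1 := ((hasDerivAt_id t).const_mul A).add
        (((((hasDerivAt_id t).sub_const p).pow 2).const_mul s).div_const 2)
      refine h1.congr_deriv ?_
      simp only [id]; push_cast; ring)
    (fun t ht => h t ⟨by linarith [ht.1], by linarith [ht.2]⟩)
  linarith

/-- The trapezoid rule: a concave function lies above its chord. -/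
theorem le_slicePrim_sub (hN : 0 < N) {a b : ℝ} (ha : 0 ≤ a) (hab : a ≤ b) (hb : b ≤ N) :
    (b - a) * (sliceFun N a + sliceFun N b) / 2 ≤ slicePrim N b - slicePrim N a := by
  rcases hab.eq_or_lt with rfl | hlt
  · simp
  set s := (sliceFun N b - sliceFun N a) / (b - a) with hs
  have hba : b - a ≠ 0 := by linarith
  have hsb : s * (b - a) = sliceFun N b - sliceFun N a := by rw [hs]; field_simp
  have := sub_le_sub_of_hasDerivAt_le (P := slicePrim N) (p := sliceFun N)
    (F := fun t => sliceFun N a * t + s * (t - a) ^ 2 / 2)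
    (f := fun t => sliceFun N a + s * (t - a)) hab
    (by fun_prop)
    ((continuousOn_slicePrim hN).mono (Set.Icc_subset_Icc ha hb))
    (fun t _ => by
      have h1 := ((hasDerivAt_id t).const_mul (sliceFun N a)).add
        (((((hasDerivAt_id t).sub_const a).pow 2).const_mul s).div_const 2)
      refine h1.congr_deriv ?_
      simp only [id]; push_cast; ring)
    (fun t ht => hasDerivAt_slicePrim (by linarith [ht.1]) (by linarith [ht.2]))
    (fun t ht => by
      have hc := (concaveOn_sliceFun hN).2 (show a ∈ Set.Icc 0 N from ⟨ha, by linarith⟩)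
        (show b ∈ Set.Icc 0 N from ⟨by linarith, hb⟩)
        (div_nonneg (by linarith [ht.2]) (by linarith) : 0 ≤ (b - t) / (b - a))
        (div_nonneg (by linarith [ht.1]) (by linarith) : 0 ≤ (t - a) / (b - a))
        (by field_simp; ring)
      simp only [smul_eq_mul] at hc
      have e1 : (b - t) / (b - a) * a + (t - a) / (b - a) * b = t := by field_simp; ring
      have e2 : (b - t) / (b - a) * sliceFun N a + (t - a) / (b - a) * sliceFun N b =
          sliceFun N a + s * (t - a) := by rw [hs]; field_simp; ring
      rw [e1, e2] at hc
      exact hc)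
  nlinarith

theorem sum_sliceFun_le (hN : 0 < N) {K : ℕ} (hK : (K : ℝ) ≤ N) :
    ∑ k ∈ Finset.Icc 1 K, sliceFun N k ≤
      slicePrim N K - slicePrim N 0 + sliceFun N K / 2 := by
  induction K with
  | zero => simp [sliceFun_zero]
  | succ K ih =>
    push_cast at hK ⊢
    have h := le_slicePrim_sub hN (Nat.cast_nonneg K) (by linarith) hK
    rw [Finset.sum_Icc_succ_top (by omega)]
    push_cast
    linarith [ih (by linarith)]

/-- The chord bound `sliceFun N q` ≤ (3N/2)q, integrated over [0, 1/2]. -/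
theorem slicePrim_half_sub_zero_le (hN : 1 ≤ N) :
    slicePrim N (1 / 2) - slicePrim N 0 ≤ 3 * N / 16 := by
  have := slicePrim_sub_le (N := N) (a := 0) (b := 1 / 2) (A := 0) (s := 3 * N / 2) (p := 0)
    (by linarith) le_rfl (by norm_num) (by linarith) (fun q hq => by
      unfold sliceFun
      have hpos : 0 ≤ N ^ 2 - q ^ 2 := by nlinarith [hq.1, hq.2]
      have hsq := Real.sq_sqrt hpos
      have hb0 := Real.sqrt_nonneg (N ^ 2 - q ^ 2)
      set b := Real.sqrt (N ^ 2 - q ^ 2)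
      have hbN : b ≤ N := by nlinarith [sq_nonneg q]
      have h1 : b + N ^ 2 / (N + b) ≤ 3 * N / 2 := by
        rw [← le_sub_iff_add_le', div_le_iff₀ (by linarith)]
        nlinarith
      nlinarith [hq.1])
  linarith

/-- The midpoint rule: on [k - 1/2, k + 1/2] the supporting line at k integrates to the value at k.
-/
theorem le_sum_sliceFun_sub (hN : 0 < N) {K : ℕ} (hK : (K : ℝ) + 1 / 2 ≤ N) :
    slicePrim N (K + 1 / 2) - slicePrim N (1 / 2) ≤ ∑ k ∈ Finset.Icc 1 K, sliceFun N k := by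
  induction K with
  | zero => simp
  | succ K ih =>
    push_cast at hK ⊢
    have hK0 : (0 : ℝ) ≤ K := Nat.cast_nonneg K
    obtain ⟨s, -, hs⟩ := exists_sliceFun_le_tangent hN (p := K + 1) (by linarith) (by linarith)
    have h := slicePrim_sub_le hN (a := K + 1 / 2) (b := K + 1 + 1 / 2) (by linarith)
      (by linarith) hK hs
    rw [Finset.sum_Icc_succ_top (by omega)]
    push_cast
    nlinarith [ih (by linarith)]

/-- Midpoint rule on the interior, plus the two ends. The last terms on the left are the signed
integral of the tangent at N from K + 1/2 to N. -/
theorem le_sum_sliceFun {K : ℕ} (hK1 : 1 ≤ K) (hK : (K : ℝ) ≤ N) (hK' : N < K + 1) :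
    N ^ 3 * (4 / 3 - Real.log 2) - 3 * N / 16 - (N - K - 1 / 2) * N ^ 2 -
      N * (N - K - 1 / 2) ^ 2 / 2 ≤ ∑ k ∈ Finset.Icc 1 K, sliceFun N k := by
  have hK1' : (1 : ℝ) ≤ K := by exact_mod_cast hK1
  have hN : 0 < N := by linarith
  have hhalf := slicePrim_half_sub_zero_le (N := N) (by linarith)
  rw [← slicePrim_self_sub_zero hN]
  obtain ⟨J, rfl⟩ : ∃ J, K = J + 1 := ⟨K - 1, by omega⟩
  have hsum := le_sum_sliceFun_sub hN (K := J) (by push_cast at hK; linarith)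
  rw [Finset.sum_Icc_succ_top (by omega)]
  have hJ : ((J + 1 : ℕ) : ℝ) = J + 1 := by push_cast; ring
  rw [hJ] at hK hK' hK1' ⊢
  have hJ0 : (0 : ℝ) ≤ J := Nat.cast_nonneg J
  obtain ⟨s, hs0, hs⟩ := exists_sliceFun_le_tangent hN (p := (J : ℝ) + 1) (by linarith) hK
  set u := N - (J + 1) with hu
  suffices h : slicePrim N N - slicePrim N (J + 1 / 2) ≤
      sliceFun N (J + 1) + (u - 1 / 2) * N ^ 2 + N * (u - 1 / 2) ^ 2 / 2 by linarith
  -- If u ≤ 1/2, one supporting line at K serves up to N and is compared with the tangent at N by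
  -- means of its slope bound; otherwise the tangent at N takes over beyond K + 1/2.
  rcases le_or_gt u (1 / 2) with h | h
  · have h1 := slicePrim_sub_le hN (a := J + 1 / 2) (b := N) (by linarith) (by linarith) le_rfl hs
    have h2 := hs N ⟨hN.le, le_rfl⟩
    rw [sliceFun_self hN] at h2
    have e1 : N - (J + 1 / 2) = u + 1 / 2 := by rw [hu]; ring
    have e2 : (J : ℝ) + 1 / 2 - (J + 1) = -(1 / 2) := by ring
    rw [e1, e2, ← hu] at h1
    rw [← hu] at h2
    have hd : 0 ≤ 1 / 2 - u := by linarith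
    nlinarith [mul_le_mul_of_nonneg_left h2 hd,
      mul_le_mul_of_nonneg_left hs0 (mul_nonneg hd hd)]
  · have h1 := slicePrim_sub_le hN (a := J + 1 / 2) (b := J + 1 + 1 / 2) (by linarith)
      (by linarith) (by linarith) hs
    have h2 := slicePrim_sub_le hN (a := J + 1 + 1 / 2) (b := N) (by linarith)
      (by linarith) le_rfl (fun q hq => sliceFun_le_tangent_self hN hq)
    have e1 : N - (J + 1 + 1 / 2) = u - 1 / 2 := by rw [hu]; ring
    have e2 : (J : ℝ) + 1 + 1 / 2 - N = -(u - 1 / 2) := by rw [hu]; ring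
    rw [e1, e2] at h2
    nlinarith

theorem sum_sliceFun_le_main {K : ℕ} (hK1 : 1 ≤ K) (hK : (K : ℝ) ≤ N) (hK' : N < K + 1) :
    ∑ k ∈ Finset.Icc 1 K, sliceFun N k ≤ N ^ 3 * (4 / 3 - Real.log 2) -
      (N - K) * N ^ 2 / 2 + (1 - (N - K)) * (N ^ 2 + (N - K) * N) / 2 := by
  have hK1' : (1 : ℝ) ≤ K := by exact_mod_cast hK1
  have hN : 0 < N := by linarith
  have h1 := sum_sliceFun_le hN hK
  have h2 := le_slicePrim_sub hN (a := K) (b := N) (by linarith) hK le_rfl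
  have h3 := sliceFun_le_tangent_self hN (q := K) ⟨by linarith, hK⟩
  rw [← slicePrim_self_sub_zero hN]
  rw [sliceFun_self hN] at h2
  have := mul_le_mul_of_nonneg_left h3 (by linarith : 0 ≤ 1 - (N - K))
  nlinarith

end slice

/-! ### The first moment as a lattice point sum -/

/-- The cofactor r runs over the whole open range q < r < q + 2m; when (m + q)² > X it is cut off at
⌊(X - m²)/q⌋ instead. -/
theorem filter_strictPairs_of_add_le {X m q : ℕ} (hm : 1 ≤ m) (hq : 1 ≤ q)
    (h : (m + q) ^ 2 ≤ X) :
    ((Finset.Icc 1 X).filter fun d => (m, q) ∈ strictPairs d).card = 2 * m - 1 := by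
  have : (Finset.Icc 1 X).filter (fun d => (m, q) ∈ strictPairs d) =
      (Finset.Ioo q (q + 2 * m)).image fun r => m ^ 2 + q * r := by
    ext d
    simp only [Finset.mem_filter, Finset.mem_Icc, mem_strictPairs, Finset.mem_image,
      Finset.mem_Ioo]
    constructor
    · rintro ⟨-, -, -, h1, h2, r, hr⟩
      have hd : m ^ 2 + q * r = d := by
        have : m ^ 2 ≤ d := by nlinarith
        omega
      subst hd
      refine ⟨r, ⟨?_, ?_⟩, rfl⟩ <;> by_contra hc <;> push Not at hc <;>
        nlinarith [Nat.mul_le_mul_left q hc]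
    · rintro ⟨r, ⟨h1, h2⟩, rfl⟩
      have h3 := Nat.mul_lt_mul_of_pos_left h1 hq
      have h4 := Nat.mul_lt_mul_of_pos_left h2 hq
      exact ⟨⟨by nlinarith, by nlinarith⟩, hm, hq, by nlinarith, by nlinarith, r, by simp⟩
  rw [this, Finset.card_image_of_injective _ fun a b hab => ?_, Nat.card_Ioo]
  · omega
  · exact Nat.eq_of_mul_eq_mul_left hq (Nat.add_left_cancel hab)

theorem filter_strictPairs_of_lt_add {X m q : ℕ} (hm : 1 ≤ m) (hq : 1 ≤ q)
    (h : X < (m + q) ^ 2) :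
    ((Finset.Icc 1 X).filter fun d => (m, q) ∈ strictPairs d).card = (X - m ^ 2) / q - q := by
  have : (Finset.Icc 1 X).filter (fun d => (m, q) ∈ strictPairs d) =
      (Finset.Ioc q ((X - m ^ 2) / q)).image fun r => m ^ 2 + q * r := by
    ext d
    simp only [Finset.mem_filter, Finset.mem_Icc, mem_strictPairs, Finset.mem_image,
      Finset.mem_Ioc, Nat.le_div_iff_mul_le hq]
    constructor
    · rintro ⟨⟨-, hdX⟩, -, -, h1, h2, r, hr⟩
      have hd : m ^ 2 + q * r = d := by
        have : m ^ 2 ≤ d := by nlinarith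
        omega
      subst hd
      refine ⟨r, ⟨?_, ?_⟩, rfl⟩
      · by_contra hc
        push Not at hc
        nlinarith [Nat.mul_le_mul_left q hc]
      · rw [mul_comm]; omega
    · rintro ⟨r, ⟨h1, h2⟩, rfl⟩
      have h3 := Nat.mul_lt_mul_of_pos_left h1 hq
      rw [mul_comm] at h2
      have h4 : m ^ 2 + q * r ≤ X := by omega
      exact ⟨⟨by nlinarith, h4⟩, hm, hq, by nlinarith, by omega, r, by simp⟩
  rw [this, Finset.card_image_of_injective _ fun a b hab => ?_, Nat.card_Ioc]
  exact Nat.eq_of_mul_eq_mul_left hq (Nat.add_left_cancel hab)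

theorem filter_lowPairs_card {X m q : ℕ} (hm : 1 ≤ m) (hq : 1 ≤ q) (hX : m ^ 2 + q ^ 2 ≤ X) :
    ((Finset.Icc 1 X).filter fun d => (m, q) ∈ lowPairs d).card =
      ((Finset.Icc 1 X).filter fun d => (m, q) ∈ strictPairs d).card + 1 := by
  rw [← Finset.card_insert_of_notMem (a := m ^ 2 + q ^ 2)]
  · congr 1
    ext d
    simp only [Finset.mem_insert, Finset.mem_filter, Finset.mem_Icc, mem_strictPairs,
      mem_lowPairs]
    constructor
    · rintro ⟨h1, -, -, h2, h3⟩
      rcases h2.eq_or_lt with h | h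
      · exact Or.inl h.symm
      · exact Or.inr ⟨h1, hm, hq, h, h3⟩
    · rintro (rfl | ⟨h1, -, -, h, h3⟩)
      · exact ⟨⟨by nlinarith, hX⟩, hm, hq, le_rfl, by nlinarith, q, by rw [sq q]; simp⟩
      · exact ⟨h1, hm, hq, h.le, h3⟩
  · simp [mem_strictPairs]

/-- The first moment as a sum over the lattice points of a quarter disc. -/
theorem sum_g_eq (X : ℕ) :
    ∑ d ∈ Finset.Icc 1 X, g d = ∑ q ∈ Finset.Icc 1 (Nat.sqrt X),
      ∑ m ∈ Finset.Icc 1 (Nat.sqrt (X - q ^ 2)),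
        (2 * (if m + q ≤ Nat.sqrt X then 2 * m - 1 else (X - m ^ 2) / q - q) + 1) := by
  classical
  set K := Nat.sqrt X with hK
  set B := (Finset.Icc 1 K ×ˢ Finset.Icc 1 K).filter fun p => p.1 ^ 2 + p.2 ^ 2 ≤ X with hB
  have hswap : ∀ F : ℕ → Finset (ℕ × ℕ), (∀ d, F d ⊆ lowPairs d) →
      ∑ d ∈ Finset.Icc 1 X, (F d).card =
        ∑ p ∈ B, ((Finset.Icc 1 X).filter fun d => p ∈ F d).card := by
    intro F hF
    have h1 : ∀ d ∈ Finset.Icc 1 X, (F d).card = ∑ p ∈ B, if p ∈ F d then 1 else 0 := by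
      intro d hd
      rw [Finset.mem_Icc] at hd
      rw [← Finset.card_filter]
      congr 1
      ext ⟨m, q⟩
      simp only [Finset.mem_filter]
      refine ⟨fun h => ⟨?_, h⟩, fun h => h.2⟩
      have h2 := hF d h
      rw [mem_lowPairs] at h2
      rw [hB, Finset.mem_filter, Finset.mem_product, Finset.mem_Icc, Finset.mem_Icc]
      exact ⟨⟨⟨h2.1, Nat.le_sqrt'.mpr (by nlinarith)⟩, h2.2.1, Nat.le_sqrt'.mpr (by nlinarith)⟩,
        by simp only; omega⟩
    rw [Finset.sum_congr rfl h1, Finset.sum_comm]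
    refine Finset.sum_congr rfl fun p _ => ?_
    rw [Finset.card_filter]
  have h1 : ∑ d ∈ Finset.Icc 1 X, g d = ∑ p ∈ B,
      (2 * (if p.1 + p.2 ≤ K then 2 * p.1 - 1 else (X - p.1 ^ 2) / p.2 - p.2) + 1) := by
    rw [Finset.sum_congr rfl fun d _ => g_eq d, Finset.sum_add_distrib,
      hswap lowPairs fun d => Finset.Subset.refl _,
      hswap strictPairs fun d => Finset.filter_subset _ _,
      ← Finset.sum_add_distrib]
    refine Finset.sum_congr rfl fun p hp => ?_
    obtain ⟨m, q⟩ := p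
    rw [hB, Finset.mem_filter, Finset.mem_product, Finset.mem_Icc, Finset.mem_Icc] at hp
    obtain ⟨⟨⟨hm, -⟩, hq, -⟩, hX⟩ := hp
    rw [filter_lowPairs_card hm hq hX]
    simp only
    split_ifs with h
    · rw [filter_strictPairs_of_add_le hm hq (Nat.le_sqrt'.mp h)]
      ring
    · rw [filter_strictPairs_of_lt_add hm hq (Nat.sqrt_lt'.mp (by omega))]
      ring
  rw [h1, hB, Finset.sum_filter, Finset.sum_product_right]
  refine Finset.sum_congr rfl fun q hq => ?_
  rw [← Finset.sum_filter]
  refine Finset.sum_congr ?_ fun m _ => rfl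
  rw [Finset.mem_Icc] at hq
  have hqX : q ^ 2 ≤ X := Nat.le_sqrt'.mp hq.2
  ext m
  simp only [Finset.mem_filter, Finset.mem_Icc, Nat.le_sqrt', hK]
  constructor
  · rintro ⟨⟨h2, h3⟩, h4⟩
    exact ⟨h2, by omega⟩
  · rintro ⟨h2, h3⟩
    exact ⟨⟨h2, by omega⟩, by omega⟩

/-! ### Summation over m for fixed q -/

/-- Both ranges become initial segments, where the power sum formulas apply. -/
theorem sum_Icc_ite {A L : ℕ} (h : A ≤ L) (f c : ℕ → ℝ) :
    ∑ m ∈ Finset.Icc 1 L, (if m ≤ A then f m else c m) =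
      ∑ m ∈ Finset.Icc 1 A, f m + ∑ m ∈ Finset.Icc 1 L, c m - ∑ m ∈ Finset.Icc 1 A, c m := by
  induction L, h using Nat.le_induction with
  | base =>
    rw [Finset.sum_congr rfl fun m hm => if_pos (Finset.mem_Icc.mp hm).2]; ring
  | succ L hL ih =>
    rw [Finset.sum_Icc_succ_top (by omega), Finset.sum_Icc_succ_top (by omega), ih,
      if_neg (by omega)]
    ring

theorem mul_sliceFun {N q : ℝ} (hN : 0 < N) (hq : q ∈ Set.Icc 0 N) :
    q * sliceFun N q = N ^ 3 - Real.sqrt (N ^ 2 - q ^ 2) ^ 3 := by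
  have hpos : 0 ≤ N ^ 2 - q ^ 2 := by nlinarith [hq.1, hq.2]
  have hsq := Real.sq_sqrt hpos
  have hb0 := Real.sqrt_nonneg (N ^ 2 - q ^ 2)
  unfold sliceFun
  set b := Real.sqrt (N ^ 2 - q ^ 2)
  have h1 : q * (q * (b + N ^ 2 / (N + b))) = q ^ 2 * (b * (N + b) + N ^ 2) / (N + b) := by
    field_simp
  have h2 : q ^ 2 = (N - b) * (N + b) := by linarith
  rw [h1, h2]
  field_simp
  ring

/-- Euler–Maclaurin for a piecewise quadratic function: B₂(u) comes from the jump of the derivative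
at m = N - Q, B₂(v) from the end m = b, the cubics B₃ from the second derivatives. The 1/6 cancels
the boundary term at m = 0, where the slope is 2. -/
theorem slice_sum_identity {N b Q u v : ℝ} (hQ : Q ≠ 0) (hb : b ^ 2 = N ^ 2 - Q ^ 2) :
    (N - u - Q) * ((N - u - Q) + 1) +
      (b ^ 2 * (b - v) - (b - v) * ((b - v) + 1) * (2 * (b - v) + 1) / 6) / Q -
      (b ^ 2 * (N - u - Q) - (N - u - Q) * ((N - u - Q) + 1) * (2 * (N - u - Q) + 1) / 6) / Q -
      (N ^ 2 - Q ^ 2 / 3 - 2 / 3 * ((N ^ 3 - b ^ 3) / Q)) + 1 / 6 =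
      (Q * (u ^ 2 - u + 1 / 6) + (u ^ 2 - u + 1 / 6) * (N - Q) - (v ^ 2 - v + 1 / 6) * b +
        (v ^ 3 - 3 / 2 * v ^ 2 + v / 2 - (u ^ 3 - 3 / 2 * u ^ 2 + u / 2)) / 3) / Q := by
  have hgen : ∀ a p r c w e : ℝ, Q * (a - c + 1 / 6) + p - r + 2 / 3 * w = e →
      a + p / Q - r / Q - (c - 2 / 3 * (w / Q)) + 1 / 6 = e / Q := by
    intro a p r c w e h
    rw [← h]
    field_simp
    ring
  apply hgen
  linear_combination (u + Q - N - 1 / 2) * hb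

/-- The sum over `m` with the integer parts removed, compared with the area of the slice. -/
theorem abs_slice_sum_sub_le {N b : ℝ} {q K L : ℕ} (hq : 1 ≤ q) (hqK : q ≤ K) (hK : (K : ℝ) ≤ N)
    (hK' : N < K + 1) (hb : b = Real.sqrt (N ^ 2 - (q : ℝ) ^ 2)) (hL : (L : ℝ) ≤ b)
    (hL' : b < L + 1) :
    |((K - q : ℕ) : ℝ) * ((K - q : ℕ) + 1) +
      (b ^ 2 * L - L * (L + 1) * (2 * L + 1) / 6) / q -
      (b ^ 2 * (K - q : ℕ) - (K - q : ℕ) * ((K - q : ℕ) + 1) * (2 * (K - q : ℕ) + 1) / 6) / q -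
      (N ^ 2 - (q : ℝ) ^ 2 / 3 - 2 / 3 * sliceFun N q) + 1 / 6| ≤ (N / 4 + 1 / 24) / q := by
  have hq0 : (0 : ℝ) < q := by exact_mod_cast hq
  have hqK' : (q : ℝ) ≤ K := by exact_mod_cast hqK
  have hN : 0 < N := by linarith
  have hslice := mul_sliceFun hN (q := q) ⟨hq0.le, by linarith⟩
  rw [← hb] at hslice
  have hb2 : b ^ 2 = N ^ 2 - (q : ℝ) ^ 2 := by
    rw [hb]; exact Real.sq_sqrt (by nlinarith)
  have hb0 : 0 ≤ b := by rw [hb]; exact Real.sqrt_nonneg _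
  have hbN : b ≤ N := by nlinarith
  rw [Nat.cast_sub hqK]
  set Q : ℝ := (q : ℝ)
  have hsl : sliceFun N Q = (N ^ 3 - b ^ 3) / Q := by
    rw [← hslice]; field_simp
  rw [hsl]
  obtain ⟨u, hu⟩ : ∃ u, u = N - K := ⟨_, rfl⟩
  obtain ⟨v, hv⟩ : ∃ v, v = b - L := ⟨_, rfl⟩
  have hKu : (K : ℝ) = N - u := by linarith
  have hLv : (L : ℝ) = b - v := by linarith
  have hu0 : 0 ≤ u := by linarith
  have hu1 : u ≤ 1 := by linarith
  have hv0 : 0 ≤ v := by linarith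
  have hv1 : v ≤ 1 := by linarith
  rw [hKu, hLv]
  rw [slice_sum_identity hq0.ne' hb2]
  rw [abs_div, abs_of_pos hq0]
  gcongr
  -- Since -1/12 ≤ B₂ ≤ 1/6 and b ≤ N, the quadratic terms give at most N/6 + N/12 = N/4; the cubic
  -- ones give 2·(1/16)/3 = 1/24.
  have hB3 : ∀ t : ℝ, 0 ≤ t → t ≤ 1 → |t ^ 3 - 3 / 2 * t ^ 2 + t / 2| ≤ 1 / 16 := by
    intro t h0 h1
    rw [abs_le]
    constructor
    · have := mul_nonneg h0 (sq_nonneg (t - 3 / 4))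
      linarith
    · have := mul_nonneg (by linarith : 0 ≤ 1 - t) (sq_nonneg (t - 1 / 4))
      linarith
  have hu3 := abs_le.mp (hB3 u hu0 hu1)
  have hv3 := abs_le.mp (hB3 v hv0 hv1)
  have e1 : Q * (u ^ 2 - u + 1 / 6) + (u ^ 2 - u + 1 / 6) * (N - Q) = (u ^ 2 - u + 1 / 6) * N := by
    ring
  rw [e1]
  have hu2 : -(1 / 12) ≤ u ^ 2 - u + 1 / 6 := by nlinarith [sq_nonneg (u - 1 / 2)]
  have hu2' : u ^ 2 - u + 1 / 6 ≤ 1 / 6 := by nlinarith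
  have hv2 : -(1 / 12) ≤ v ^ 2 - v + 1 / 6 := by nlinarith [sq_nonneg (v - 1 / 2)]
  have hv2' : v ^ 2 - v + 1 / 6 ≤ 1 / 6 := by nlinarith
  have m1 := mul_le_mul_of_nonneg_right hu2 hN.le
  have m2 := mul_le_mul_of_nonneg_right hu2' hN.le
  have m3 := mul_le_mul_of_nonneg_right hv2 hb0
  have m4 := mul_le_mul_of_nonneg_right hv2' hb0
  rw [abs_le]
  constructor <;> linarith

section firstMoment

variable {x : ℝ}

theorem natSqrt_floor_le_sqrt (hx : 0 ≤ x) : (Nat.sqrt ⌊x⌋₊ : ℝ) ≤ Real.sqrt x := by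
  refine Real.le_sqrt_of_sq_le ?_
  calc ((Nat.sqrt ⌊x⌋₊ : ℝ)) ^ 2 ≤ ⌊x⌋₊ := by exact_mod_cast Nat.sqrt_le' _
    _ ≤ x := Nat.floor_le hx

theorem sqrt_lt_natSqrt_floor_add_one (x : ℝ) : Real.sqrt x < Nat.sqrt ⌊x⌋₊ + 1 := by
  rw [Real.sqrt_lt' (by positivity)]
  have h1 : ⌊x⌋₊ + 1 ≤ (Nat.sqrt ⌊x⌋₊ + 1) ^ 2 := Nat.lt_succ_sqrt' _
  have h2 : (⌊x⌋₊ : ℝ) + 1 ≤ ((Nat.sqrt ⌊x⌋₊ : ℝ) + 1) ^ 2 := by exact_mod_cast h1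
  linarith [Nat.lt_floor_add_one x]

theorem sq_add_sq_le_of_le_natSqrt {X m q : ℕ} (hq : q ≤ Nat.sqrt X)
    (hm : m ≤ Nat.sqrt (X - q ^ 2)) : m ^ 2 + q ^ 2 ≤ X := by
  have h1 := Nat.le_sqrt'.mp hq
  have h2 := Nat.le_sqrt'.mp hm
  omega

theorem sub_le_natSqrt_sub_sq {X q : ℕ} (hq : q ≤ Nat.sqrt X) :
    Nat.sqrt X - q ≤ Nat.sqrt (X - q ^ 2) := by
  obtain ⟨j, hj⟩ := Nat.exists_eq_add_of_le hq
  have h1 := Nat.sqrt_le' X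
  rw [hj] at h1 ⊢
  rw [Nat.le_sqrt', Nat.add_sub_cancel_left]
  have : j ^ 2 + q ^ 2 ≤ X := by nlinarith
  omega

/-- The lower and upper bounds for one summand of `sum_g_eq`. -/
theorem summand_bounds (hx : 0 ≤ x) {m q : ℕ} (hm : 1 ≤ m) (hq : 1 ≤ q)
    (hX : m ^ 2 + q ^ 2 ≤ ⌊x⌋₊) (K : ℕ) (hqK : q ≤ K) :
    2 * (if m ≤ K - q then 2 * (m : ℝ) else (x - (q : ℝ) ^ 2 - (m : ℝ) ^ 2) / q) - 1 ≤
      ((2 * (if m + q ≤ K then 2 * m - 1 else (⌊x⌋₊ - m ^ 2) / q - q) + 1 : ℕ) : ℝ) ∧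
    ((2 * (if m + q ≤ K then 2 * m - 1 else (⌊x⌋₊ - m ^ 2) / q - q) + 1 : ℕ) : ℝ) ≤
      2 * (if m ≤ K - q then 2 * (m : ℝ) else (x - (q : ℝ) ^ 2 - (m : ℝ) ^ 2) / q) + 1 -
        2 * (if m ≤ K - q then 1 else 0) := by
  have hq0 : (0 : ℝ) < q := by exact_mod_cast hq
  by_cases h : m + q ≤ K
  · have h' : m ≤ K - q := by omega
    simp only [if_pos h, if_pos h']
    push_cast [Nat.cast_sub (by omega : 1 ≤ 2 * m)]
    constructor <;> linarith
  · have h' : ¬ m ≤ K - q := by omega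
    simp only [if_neg h, if_neg h']
    set X := ⌊x⌋₊ with hXdef
    have hle : q ≤ (X - m ^ 2) / q := by
      rw [Nat.le_div_iff_mul_le hq, ← sq]; omega
    have h1 : q * ((X - m ^ 2) / q) + m ^ 2 ≤ X := by
      have := Nat.mul_div_le (X - m ^ 2) q
      omega
    have h2 : X + 1 ≤ q * ((X - m ^ 2) / q + 1) + m ^ 2 := by
      have := Nat.lt_mul_div_succ (X - m ^ 2) hq
      omega
    push_cast [Nat.cast_sub hle]
    set r : ℝ := (((X - m ^ 2) / q : ℕ) : ℝ) with hr
    have h1' : (q : ℝ) * r + (m : ℝ) ^ 2 ≤ X := by rw [hr]; exact_mod_cast h1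
    have h2' : (X : ℝ) + 1 ≤ q * (r + 1) + (m : ℝ) ^ 2 := by rw [hr]; exact_mod_cast h2
    have hXx : (X : ℝ) ≤ x := Nat.floor_le hx
    have hxX : x < X + 1 := Nat.lt_floor_add_one x
    have e1 : r - q ≤ (x - (q : ℝ) ^ 2 - (m : ℝ) ^ 2) / q := by
      rw [le_div_iff₀ hq0]; nlinarith
    have e2 : (x - (q : ℝ) ^ 2 - (m : ℝ) ^ 2) / q ≤ r - q + 1 := by
      rw [div_le_iff₀ hq0]; nlinarith
    constructor <;> linarith

theorem sum_sub_sq_div (c Q : ℝ) (M : ℕ) :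
    ∑ m ∈ Finset.Icc 1 M, (c - (m : ℝ) ^ 2) / Q =
      (c * M - M * (M + 1) * (2 * M + 1) / 6) / Q := by
  rw [← Finset.sum_div, Finset.sum_sub_distrib, sum_Icc_cast_sq, Finset.sum_const, Nat.card_Icc,
    nsmul_eq_mul]
  simp only [add_tsub_cancel_right]
  ring

/-- The contribution of a fixed `q` to the first moment. -/
theorem slice_bounds (hx : 1 ≤ x) {q : ℕ} (hq : 1 ≤ q) (hqK : q ≤ Nat.sqrt ⌊x⌋₊) :
    let N := Real.sqrt x
    let K := Nat.sqrt ⌊x⌋₊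
    let L := Nat.sqrt (⌊x⌋₊ - q ^ 2)
    let T := ((∑ m ∈ Finset.Icc 1 L,
      (2 * (if m + q ≤ K then 2 * m - 1 else (⌊x⌋₊ - m ^ 2) / q - q) + 1) : ℕ) : ℝ)
    let H := N ^ 2 - (q : ℝ) ^ 2 / 3 - 2 / 3 * sliceFun N q
    2 * H - 1 / 3 - (N / 2 + 1 / 12) * (1 / q) - L ≤ T ∧
    T ≤ 2 * H - 1 / 3 + (N / 2 + 1 / 12) * (1 / q) + L - 2 * (K - q) := by
  intro N K L T H
  have hx0 : 0 ≤ x := by linarith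
  have hqX : q ^ 2 ≤ ⌊x⌋₊ := Nat.le_sqrt'.mp hqK
  have hNsq : N ^ 2 = x := Real.sq_sqrt hx0
  -- Identifies L with the integer part of √(x - q²).
  have hfl : ⌊x - (q : ℝ) ^ 2⌋₊ = ⌊x⌋₊ - q ^ 2 := by
    have := Nat.floor_sub_natCast x (q ^ 2)
    push_cast at this
    exact this
  have hxq : 0 ≤ x - (q : ℝ) ^ 2 := by
    have : ((q ^ 2 : ℕ) : ℝ) ≤ x := (Nat.cast_le.mpr hqX).trans (Nat.floor_le hx0)
    push_cast at this
    linarith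
  have hL : (L : ℝ) ≤ Real.sqrt (x - (q : ℝ) ^ 2) := by
    have := natSqrt_floor_le_sqrt hxq
    rwa [hfl] at this
  have hL' : Real.sqrt (x - (q : ℝ) ^ 2) < L + 1 := by
    have := sqrt_lt_natSqrt_floor_add_one (x - (q : ℝ) ^ 2)
    rwa [hfl] at this
  have habs := abs_slice_sum_sub_le (N := N) hq hqK (natSqrt_floor_le_sqrt hx0)
    (sqrt_lt_natSqrt_floor_add_one x) (b := Real.sqrt (x - (q : ℝ) ^ 2)) (by rw [hNsq]) hL hL'
  rw [Real.sq_sqrt hxq] at habs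
  have hAL : K - q ≤ L := sub_le_natSqrt_sub_sq hqK
  have hI := sum_Icc_ite hAL (fun m => 2 * (m : ℝ))
    (fun m => (x - (q : ℝ) ^ 2 - (m : ℝ) ^ 2) / q)
  rw [sum_sub_sq_div, sum_sub_sq_div, ← Finset.mul_sum, sum_Icc_cast] at hI
  have hone : ∑ m ∈ Finset.Icc 1 L, (if m ≤ K - q then (1 : ℝ) else 0) = K - q := by
    rw [sum_Icc_ite hAL (fun _ => (1 : ℝ)) (fun _ => 0)]
    simp [Nat.cast_sub hqK, K]
  have hcard : ∑ m ∈ Finset.Icc 1 L, (1 : ℝ) = L := by simp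
  have hT : T = ∑ m ∈ Finset.Icc 1 L,
      ((2 * (if m + q ≤ K then 2 * m - 1 else (⌊x⌋₊ - m ^ 2) / q - q) + 1 : ℕ) : ℝ) :=
    Nat.cast_sum _ _
  have hb : ∀ m ∈ Finset.Icc 1 L, _ := fun m hm =>
    summand_bounds hx0 (Finset.mem_Icc.mp hm).1 hq
      (sq_add_sq_le_of_le_natSqrt hqK (Finset.mem_Icc.mp hm).2) K hqK
  have hlow := Finset.sum_le_sum fun m hm => (hb m hm).1
  have hup := Finset.sum_le_sum fun m hm => (hb m hm).2
  rw [← hT, Finset.sum_sub_distrib, ← Finset.mul_sum, hI, hcard] at hlow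
  rw [← hT, Finset.sum_sub_distrib, Finset.sum_add_distrib, ← Finset.mul_sum, ← Finset.mul_sum,
    hI, hcard, hone] at hup
  have hdiv : (N / 4 + 1 / 24) / q = (N / 2 + 1 / 12) * (1 / q) / 2 := by ring
  rw [hdiv, abs_le] at habs
  obtain ⟨ha, hb⟩ := habs
  change _ ≤ _ - H + _ at ha
  change _ - H + _ ≤ _ at hb
  constructor <;> linarith

end firstMoment

/-! ### Error terms and assembly -/

section firstMoment

/-- K² + 2K is the largest integer with integer square root K, so the bound depends on K alone. -/
theorem sum_natSqrt_le_sum (X : ℕ) :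
    ∑ q ∈ Finset.Icc 1 (Nat.sqrt X), Nat.sqrt (X - q ^ 2) ≤
      ∑ q ∈ Finset.Icc 1 (Nat.sqrt X), Nat.sqrt (Nat.sqrt X ^ 2 + 2 * Nat.sqrt X - q ^ 2) := by
  refine Finset.sum_le_sum fun q _ => Nat.sqrt_le_sqrt (Nat.sub_le_sub_right ?_ _)
  have := Nat.lt_succ_sqrt' X
  rw [Nat.succ_eq_add_one] at this
  nlinarith

theorem sum_natSqrt_le (K : ℕ) :
    ∑ q ∈ Finset.Icc 1 K, (Nat.sqrt (K ^ 2 + 2 * K - q ^ 2) : ℝ) ≤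
      5 / 6 * (K : ℝ) * (K + 1) := by
  have hK : (0 : ℝ) < 2 * K + 1 := by positivity
  have h : ∀ q ∈ Finset.Icc 1 K, (Nat.sqrt (K ^ 2 + 2 * K - q ^ 2) : ℝ) ≤
      (2 * (K : ℝ) ^ 2 + 3 * K - (q : ℝ) ^ 2) / (2 * K + 1) := by
    intro q hq
    have hqK : q ^ 2 ≤ K ^ 2 + 2 * K := by nlinarith [(Finset.mem_Icc.mp hq).2]
    have h1 := Nat.sqrt_le' (K ^ 2 + 2 * K - q ^ 2)
    set L := Nat.sqrt (K ^ 2 + 2 * K - q ^ 2)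
    have h2 : (L : ℝ) ^ 2 + (q : ℝ) ^ 2 ≤ (K : ℝ) ^ 2 + 2 * K := by
      have : L ^ 2 + q ^ 2 ≤ K ^ 2 + 2 * K := by omega
      exact_mod_cast this
    -- No integer lies strictly between K and K + 1; this bounds L linearly by L² and leads to 5/6,
    -- between π/4 and 1.
    have h3 : (0 : ℝ) ≤ ((L : ℝ) - K) * (L - K - 1) := by
      rcases le_or_gt L K with h | h
      · have : (L : ℝ) ≤ K := by exact_mod_cast h
        nlinarith
      · have : (K : ℝ) + 1 ≤ L := by exact_mod_cast h
        nlinarith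
    rw [le_div_iff₀ hK]
    nlinarith
  refine (Finset.sum_le_sum h).trans ?_
  rw [← Finset.sum_div, Finset.sum_sub_distrib, sum_Icc_cast_sq, Finset.sum_const, Nat.card_Icc,
    nsmul_eq_mul, div_le_iff₀ hK]
  simp only [add_tsub_cancel_right]
  have : (0 : ℝ) ≤ K := Nat.cast_nonneg K
  nlinarith

/-- A linear bound suffices: after multiplication by N/2 it costs about N²/20, less than the gap 1 -
5/6. -/
theorem sum_inv_le {K : ℕ} (hK : 10 ≤ K) :
    ∑ q ∈ Finset.Icc 1 K, 1 / (q : ℝ) ≤ 2 + (K : ℝ) / 10 := by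
  induction K, hK using Nat.le_induction with
  | base => norm_num [Finset.sum_Icc_succ_top]
  | succ K hK ih =>
    rw [Finset.sum_Icc_succ_top (by omega)]
    have hK' : (10 : ℝ) ≤ K := by exact_mod_cast hK
    have : 1 / ((K + 1 : ℕ) : ℝ) ≤ 1 / 10 := by
      push_cast
      apply one_div_le_one_div_of_le <;> linarith
    push_cast at this ⊢
    linarith

theorem sum_natSqrt_le_of_lt_ten : ∀ K < 10,
    (∑ q ∈ Finset.Icc 1 K, Nat.sqrt (K ^ 2 + 2 * K - q ^ 2)) ≤
      [0, 1, 4, 8, 13, 22, 30, 41, 54, 67].getD K 0 := by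
  decide +kernel

/-- The lattice point error terms are absorbed by the gap between the quarter disc and its
bounding square. -/
theorem error_terms_le {N : ℝ} {K : ℕ} (hK1 : 1 ≤ K) (hK : (K : ℝ) ≤ N) (hK' : N < K + 1) :
    (∑ q ∈ Finset.Icc 1 K, Nat.sqrt (K ^ 2 + 2 * K - q ^ 2) : ℕ) + 11 / 36 * N + 1 / 72 -
        (K : ℝ) / 3 + (N / 2 + 1 / 12) * ∑ q ∈ Finset.Icc 1 K, 1 / (q : ℝ) ≤
      (K : ℝ) * (K - 1) + 2 * N ∧
    (∑ q ∈ Finset.Icc 1 K, Nat.sqrt (K ^ 2 + 2 * K - q ^ 2) : ℕ) + 1 / 9 * N + 1 / 72 +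
        (K : ℝ) / 3 + (N / 2 + 1 / 12) * ∑ q ∈ Finset.Icc 1 K, 1 / (q : ℝ) ≤
      N ^ 2 + 2 * N := by
  rcases le_or_gt 10 K with h | h
  · have hD := sum_natSqrt_le K
    have hH := sum_inv_le h
    have h10 : (10 : ℝ) ≤ K := by exact_mod_cast h
    have hmul := mul_le_mul_of_nonneg_left hH (by linarith : 0 ≤ N / 2 + 1 / 12)
    push_cast
    constructor
    · rcases le_or_gt (K : ℝ) 13 with h13 | h13
      · nlinarith
      · nlinarith
    · nlinarith
  · have hD := sum_natSqrt_le_of_lt_ten K h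
    interval_cases K <;>
    · simp only [List.getD_cons_succ, List.getD_cons_zero] at hD
      have hD' := (Nat.cast_le (α := ℝ)).mpr hD
      generalize ((∑ q ∈ Finset.Icc 1 _, Nat.sqrt (_ - q ^ 2) : ℕ) : ℝ) = D at hD' ⊢
      norm_num [Finset.sum_Icc_succ_top] at hD' hK hK' ⊢
      constructor <;> nlinarith

/-- The first moment up to an error of at most `(x + 4√x) / 2` around its centre. -/
theorem sum_g_bounds {x : ℝ} (hx : 1 < x) :
    c₁ * x ^ (3 / 2 : ℝ) - 2 * x - 2 * Real.sqrt x ≤ ∑ d ∈ Finset.Icc 1 ⌊x⌋₊, (g d : ℝ) ∧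
    ∑ d ∈ Finset.Icc 1 ⌊x⌋₊, (g d : ℝ) ≤ c₁ * x ^ (3 / 2 : ℝ) - x + 2 * Real.sqrt x := by
  have hx0 : 0 ≤ x := by linarith
  set N := Real.sqrt x with hN
  set K := Nat.sqrt ⌊x⌋₊ with hKdef
  have hNsq : N ^ 2 = x := Real.sq_sqrt hx0
  have hK : (K : ℝ) ≤ N := natSqrt_floor_le_sqrt hx0
  have hK' : N < K + 1 := sqrt_lt_natSqrt_floor_add_one x
  have hK1 : 1 ≤ K := by
    rw [hKdef, Nat.le_sqrt', one_pow]
    exact Nat.le_floor (by exact_mod_cast hx.le)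
  have hcube : x ^ (3 / 2 : ℝ) = N ^ 3 := by
    rw [hN, Real.sqrt_eq_rpow, ← Real.rpow_natCast, ← Real.rpow_mul hx0]
    norm_num
  have hslice : ∀ q ∈ Finset.Icc 1 K, _ := fun q hq =>
    slice_bounds hx.le (Finset.mem_Icc.mp hq).1 (Finset.mem_Icc.mp hq).2
  simp only [← hKdef, ← hN] at hslice
  have hS : ∑ d ∈ Finset.Icc 1 ⌊x⌋₊, (g d : ℝ) = ∑ q ∈ Finset.Icc 1 K,
      ((∑ m ∈ Finset.Icc 1 (Nat.sqrt (⌊x⌋₊ - q ^ 2)),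
        (2 * (if m + q ≤ K then 2 * m - 1 else (⌊x⌋₊ - m ^ 2) / q - q) + 1) : ℕ) : ℝ) := by
    rw [← Nat.cast_sum, sum_g_eq, Nat.cast_sum]
  have hlow := Finset.sum_le_sum fun q hq => (hslice q hq).1
  have hup := Finset.sum_le_sum fun q hq => (hslice q hq).2
  have hD : ∑ q ∈ Finset.Icc 1 K, (Nat.sqrt (⌊x⌋₊ - q ^ 2) : ℝ) ≤
      (∑ q ∈ Finset.Icc 1 K, Nat.sqrt (K ^ 2 + 2 * K - q ^ 2) : ℕ) := by
    exact_mod_cast sum_natSqrt_le_sum ⌊x⌋₊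
  have hconst : ∀ c : ℝ, ∑ q ∈ Finset.Icc 1 K, c = K * c := fun c => by simp
  rw [← hS] at hlow hup
  simp only [Finset.sum_sub_distrib, Finset.sum_add_distrib, ← Finset.mul_sum, ← Finset.sum_div,
    sum_Icc_cast_sq, sum_Icc_cast, hconst] at hlow hup
  obtain ⟨herr, herr'⟩ := error_terms_le hK1 hK hK'
  have hψ := le_sum_sliceFun hK1 hK hK'
  have hψ' := sum_sliceFun_le_main hK1 hK hK'
  rw [hcube, c₁]
  obtain ⟨u, hu⟩ : ∃ u, u = N - K := ⟨_, rfl⟩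
  have hKu : (K : ℝ) = N - u := by linarith
  have hu0 : 0 ≤ u := by linarith
  have hu1 : u ≤ 1 := by linarith
  have hcub : u * (1 - u) * (1 - 2 * u) ≤ 1 / 8 := by
    have := mul_nonneg (by linarith : 0 ≤ 1 - u) (sq_nonneg (u - 1 / 4))
    linarith
  have hcub' : -(1 / 8) ≤ u * (1 - u) * (1 - 2 * u) := by
    have := mul_nonneg hu0 (sq_nonneg (u - 3 / 4))
    linarith
  -- With K = N - u the terms B₂(u)N from Σ q² cancel against the end corrections for `sliceFun`,
  -- leaving 11N/36 = N/4 + N/18 above and N/9 below; the cubic 2B₃(u) leaves (1/9)(1/8) = 1/72.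
  rw [hKu] at hlow hup herr herr' hψ hψ'
  constructor <;> linarith

end firstMoment

theorem c₁_bounds : 0.9241 ≤ c₁ ∧ c₁ < 0.9242 := by
  have h1 := Real.log_two_gt_d9
  have h2 := Real.log_two_lt_d9
  unfold c₁
  constructor <;> linarith

theorem theorem1 :
    (0.9241 ≤ c₁ ∧ c₁ < 0.9242) ∧
    ∀ x : ℝ, 1 < x →
      (∃ θ ∈ Set.Icc (0 : ℝ) 1,
        ∑ d ∈ Finset.Icc 1 ⌊x⌋₊, (g d : ℝ) =
          c₁ * x ^ (3 / 2 : ℝ) - 2 * x - 2 * Real.sqrt x + θ * (x + 4 * Real.sqrt x)) ∧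
      ∑ d ∈ Finset.Icc 1 ⌊x⌋₊, (g d : ℝ) ^ 2 ≤
        11.9 * x ^ 2 + 5 * x ^ (3 / 2 : ℝ) * (Real.log (4 * Real.exp 4 * x)) ^ 2 := by
  refine ⟨c₁_bounds, fun x hx => ⟨?_, sum_g_sq_le hx⟩⟩
  obtain ⟨h1, h2⟩ := sum_g_bounds hx
  have hpos : 0 < x + 4 * Real.sqrt x := by positivity
  refine ⟨(∑ d ∈ Finset.Icc 1 ⌊x⌋₊, (g d : ℝ) -
    (c₁ * x ^ (3 / 2 : ℝ) - 2 * x - 2 * Real.sqrt x)) / (x + 4 * Real.sqrt x), ⟨?_, ?_⟩, ?_⟩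
  · exact div_nonneg (by linarith) hpos.le
  · rw [div_le_one hpos]
    linarith
  · rw [div_mul_cancel₀ _ hpos.ne']
    ring
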